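/- **Setting.** A measurable function $L:(0,\infty)\to(0,\infty)$ is *slowly varying* if $L(tr)/L(r)\to1$ as $r\to\infty$ for every $t>0$. Let $\kappa\ge 1$ be an integer and $0<\alpha<2/\kappa$; let $H_\kappa(x)=(-1)^\kappa e^{x^2/2}\frac{d^\kappa}{dx^\kappa}e^{-x^2/2}$ be the $\kappa$-th Hermite polynomial. *The field.* Let $\xi(x)$, $x\in\mathbb R^2$, be a measurable, mean-square continuous, zero-mean, homogeneous isotropic real Gaussian random field with covariance $\mathbb E\,\xi(x)\xi(y)=B(\|x-y\|)$, where $B(0)=1$ and $B(t)=t^{-\alpha}L_0(t)$ for $t>0$ with $L_0$ slowly varying. Assume that $\xi$ has the isotropic spectral density $$\varphi(u)=\frac{\Gamma((2-\alpha)/2)}{2^{\alpha}\pi\,\Gamma(\alpha/2)}\,u^{\alpha-2}L(1/u),\qquad u>0,$$ i.e. $u\varphi(u)\in L_1(0,\infty)$ and $B(t)=2\pi\int_0^\infty J_0(tu)\,u\varphi(u)\,du$ for $t\ge0$ ($J_0$ the Bessel function of the first kind of order $0$), where $L$ is slowly varying, locally bounded, and $L(t)/L_0(t)\to1$ as $t\to\infty$.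 *The window.* Let $\Delta\subset\mathbb R^2$ be a compact Jordan-measurable set with the origin in its interior, of the form $\Delta=\{(x,y):a\le x\le b,\ f_l(x)\le y\le f_u(x)\}$, where $a$ and $b$ are the minimum and the maximum of $x$ over $(x,y)\in\Delta$, $f_l<f_u$ on $(a,b)$, and each of $f_l,f_u$ is $C^1$ on $[a,b]$ outside a finite set of points of $[a,b]$, at which it has finite one-sided limits. For $r>0$ let $\Delta(r)=r\Delta$ and $f_{q,r}(x)=rf_q(x/r)$ for $q\in\{l,u\}$. For an integer $i$ put $$f^{(l)}_r(i)=\Big\lfloor\inf_{x\in I_r(i)}f_{l,r}(x)\Big\rfloor,\qquad f^{(u)}_r(i)=\Big\lceil\sup_{x\in I_r(i)}f_{u,r}(x)\Big\rceil ,$$ where $I_r(i)=[i,i+1)\cap[ar,br]$, except that $I_r(i)=(i,br]\cap[ar,br]$ if $br\in(i,i+1)$. Sums over $j$ from $f^{(l)}_r(i)$ to $f^{(u)}_r(i)$ are empty if $I_r(i)$ is empty. *The weight.* Let $g:\mathbb R^2\to\mathbb R$ be measurable and bounded on bounded sets, with $r^{4-\alpha\kappa}g^2(r,r)L^\kappa(r)\to\infty$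 as $r\to\infty$. Assume that for some $\varepsilon>0$ and some function $g^*$, with $\Delta_\varepsilon:=(1+\varepsilon)\Delta$, $$\frac{g(ru,rv)}{g(r,r)}\to g^*(u,v)\quad\text{uniformly for }(u,v)\in\Delta_\varepsilon\text{ as }r\to\infty,\qquad \int_{\Delta_\varepsilon}\int_{\Delta_\varepsilon}\frac{|g^*(p)g^*(q)|}{\|p-q\|^{\kappa\alpha}}\,dp\,dq<\infty,$$ and that $g^*$, as a function on $\Delta_\varepsilon$, is continuous at almost every point of $\Delta_\varepsilon$. Assume moreover that $\Delta$ is contained in the interior of $\Delta_\varepsilon$, or that $g^*(t,t)\ne0$ for some $t\in(0,1)$ with $(t,t)\in\Delta_\varepsilon$. **Theorem.** For every $r>0$ the integral $\int_{\Delta(r)}g(x,y)H_\kappa(\xi(x,y))\,dx\,dy$ converges absolutely almost surely, the difference in the brackets below is square-integrable, and $$\lim_{r\to\infty}\frac{\mathbb E\Big[\int_{\Delta(r)}g(x,y)H_\kappa(\xi(x,y))\,dx\,dy-\sum_{i=\lfloor ar\rfloor}^{\lceil br\rceil}\ \sum_{j=f^{(l)}_r(i)}^{f^{(u)}_r(i)}g(i,j)H_\kappa(\xi(i,j))\Big]^2}{r^{4-\alpha\kappa}L^\kappa(r)\,g^2(r,r)}=0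 .$$ -/

import Mathlib

open MeasureTheory ProbabilityTheory Filter Topology
open scoped Pointwise

/-- The Euclidean plane. -/
abbrev Plane : Type := EuclideanSpace ℝ (Fin 2)

/-- `L : (0, ∞) → (0, ∞)` is measurable and slowly varying at infinity
(only the values on `(0, ∞)` matter). -/
structure SlowlyVarying (L : ℝ → ℝ) : Prop where
  measurable : Measurable (fun t : Set.Ioi (0 : ℝ) => L t)
  pos : ∀ t : ℝ, 0 < t → 0 < L t
  tendsto : ∀ t : ℝ, 0 < t → Tendsto (fun r : ℝ => L (t * r) / L r) atTop (𝓝 1)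

/-- A measurable, mean-square continuous, zero-mean, homogeneous isotropic Gaussian random field
on the plane with covariance function `B` (as a function of the distance). -/
structure IsGaussianField {Ω : Type*} [MeasurableSpace Ω] (μ : Measure Ω)
    (ξ : Plane → Ω → ℝ) (B : ℝ → ℝ) : Prop where
  measurable : Measurable (fun p : Plane × Ω => ξ p.1 p.2)
  gaussian : IsGaussianProcess ξ μ
  mean_zero : ∀ x : Plane, ∫ ω, ξ x ω ∂μ = 0
  covariance : ∀ x y : Plane, ∫ ω, ξ x ω * ξ y ω ∂μ = B ‖x - y‖
  meanSquare_continuous :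
    ∀ x : Plane, Tendsto (fun y : Plane => ∫ ω, (ξ y ω - ξ x ω) ^ 2 ∂μ) (𝓝 x) (𝓝 0)

/-- The covariance function has unit variance and decays like `t ^ (-α)` up to the slowly
varying factor `L₀`. -/
structure CovarianceCondition (α : ℝ) (B L₀ : ℝ → ℝ) : Prop where
  at_zero : B 0 = 1
  slowlyVarying : SlowlyVarying L₀
  eq : ∀ t : ℝ, 0 < t → B t = t ^ (-α) * L₀ t

/-- The Bessel function of the first kind of order zero. -/
noncomputable def besselJ0 (x : ℝ) : ℝ :=
  ∑' k : ℕ, (-1 : ℝ) ^ k / ((k.factorial : ℝ) ^ 2) * (x / 2) ^ (2 * k)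

/-- `φ` is the isotropic spectral density on the plane of the covariance function `B`:
`u φ(u)` is integrable on `[0, ∞)`, and `B(t) = ∫ J₀(t u) dΦ(u)` with `dΦ(u) = 2 π u φ(u) du`. -/
def IsIsotropicSpectralDensity (B φ : ℝ → ℝ) : Prop :=
  (∀ u : ℝ, 0 < u → 0 ≤ φ u) ∧
  IntegrableOn (fun u : ℝ => u * φ u) (Set.Ioi 0) ∧
  ∀ t : ℝ, 0 ≤ t → B t = ∫ u in Set.Ioi (0 : ℝ), besselJ0 (t * u) * (2 * Real.pi * u * φ u)

/-- The constant `c₁(2, α)`. -/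
noncomputable def spectralConst (α : ℝ) : ℝ :=
  Real.Gamma ((2 - α) / 2) / (2 ^ α * Real.pi * Real.Gamma (α / 2))

/-- The field has the isotropic spectral density `c₁(2, α) u ^ (α - 2) L(1 / u)`, where `L` is
locally bounded, slowly varying and equivalent to `L₀` at infinity. -/
structure SpectralCondition (α : ℝ) (B L₀ L : ℝ → ℝ) : Prop where
  slowlyVarying : SlowlyVarying L
  locallyBounded : ∀ s t : ℝ, 0 < s → s ≤ t → BddAbove (L '' Set.Icc s t)
  equivalent : Tendsto (fun t : ℝ => L t / L₀ t) atTop (𝓝 1)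
  density : IsIsotropicSpectralDensity B
    (fun u : ℝ => spectralConst α * u ^ (α - 2) * L (1 / u))

/-- `f` is `C¹` on `[a, b]` outside a finite subset of `[a, b]`, at whose points `f` has finite
one-sided limits from within `[a, b]`. -/
def PiecewiseC1 (a b : ℝ) (f : ℝ → ℝ) : Prop :=
  ∃ M : Set ℝ, M.Finite ∧ M ⊆ Set.Icc a b ∧ ContDiffOn ℝ 1 f (Set.Icc a b \ M) ∧
    (∀ x ∈ M, a < x → ∃ c : ℝ, Tendsto f (𝓝[<] x) (𝓝 c)) ∧
    (∀ x ∈ M, x < b → ∃ c : ℝ, Tendsto f (𝓝[>] x) (𝓝 c))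

/-- `Δ` is a compact Jordan-measurable window with the origin in its interior (so that it has
positive area), which is the set of points between the graphs of `fl` and `fu` over `[a, b]`. -/
structure IsWindow (Δ : Set Plane) (a b : ℝ) (fl fu : ℝ → ℝ) : Prop where
  isCompact : IsCompact Δ
  jordan : volume (frontier Δ) = 0
  zero_mem : (0 : Plane) ∈ interior Δ
  eq : Δ = {p : Plane | a ≤ p 0 ∧ p 0 ≤ b ∧ fl (p 0) ≤ p 1 ∧ p 1 ≤ fu (p 0)}
  left : IsLeast ((fun p : Plane => p 0) '' Δ) a
  right : IsGreatest ((fun p : Plane => p 0) '' Δ) b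
  lt : ∀ x : ℝ, a < x → x < b → fl x < fu x
  lower : PiecewiseC1 a b fl
  upper : PiecewiseC1 a b fu

/-- The boundary function of the window dilated by `r`. -/
noncomputable def dilated (f : ℝ → ℝ) (r x : ℝ) : ℝ := r * f (x / r)

open Classical in
/-- The part of `[a r, b r]` over which the extrema of the `i`-th column are taken: it is
`[i, i + 1)`, `[a r, i + 1)` or `(i, b r]`; it is empty only for a column not meeting
`[a r, b r]`. -/
noncomputable def columnBase (a b r : ℝ) (i : ℤ) : Set ℝ :=
  (if (i : ℝ) < b * r ∧ b * r < i + 1 then Set.Ioc (i : ℝ) (b * r) else Set.Ico (i : ℝ) (i + 1)) ∩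
    Set.Icc (a * r) (b * r)

open Classical in
/-- The row indices `j` of the `i`-th column of the discretised window: from the floor of the
infimum of the lower boundary to the ceiling of the supremum of the upper boundary. -/
noncomputable def columnRows (a b : ℝ) (fl fu : ℝ → ℝ) (r : ℝ) (i : ℤ) : Finset ℤ :=
  if (columnBase a b r i).Nonempty then
    Finset.Icc ⌊sInf (dilated fl r '' columnBase a b r i)⌋
      ⌈sSup (dilated fu r '' columnBase a b r i)⌉
  else ∅

/-- The Hermite polynomial `H_κ` (`H₂(x) = x² - 1`) as a function. -/
noncomputable def hermiteFun (κ : ℕ) (x : ℝ) : ℝ := Polynomial.aeval x (Polynomial.hermite κ)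

/-- The integral functional over the window dilated by `r`. -/
noncomputable def integralFunctional {Ω : Type*} (ξ : Plane → Ω → ℝ) (g : Plane → ℝ) (κ : ℕ)
    (Δ : Set Plane) (r : ℝ) (ω : Ω) : ℝ :=
  ∫ p in r • Δ, g p * hermiteFun κ (ξ p ω)

/-- The additive functional over the lattice points of the discretised window. -/
noncomputable def additiveFunctional {Ω : Type*} (ξ : Plane → Ω → ℝ) (g : Plane → ℝ) (κ : ℕ)
    (a b : ℝ) (fl fu : ℝ → ℝ) (r : ℝ) (ω : Ω) : ℝ :=
  ∑ i ∈ Finset.Icc ⌊a * r⌋ ⌈b * r⌉, ∑ j ∈ columnRows a b fl fu r i,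
    g !₂[(i : ℝ), (j : ℝ)] * hermiteFun κ (ξ !₂[(i : ℝ), (j : ℝ)] ω)

/-- The conditions on the weight function `g`. -/
structure WeightCondition (α : ℝ) (κ : ℕ) (L : ℝ → ℝ) (Δ : Set Plane) (g : Plane → ℝ) :
    Prop where
  measurable : Measurable g
  /-- `g` is bounded on bounded sets. -/
  locallyBounded : ∀ R : ℝ, ∃ C : ℝ, ∀ p : Plane, ‖p‖ ≤ R → |g p| ≤ C
  growth : Tendsto (fun r : ℝ => r ^ (4 - α * κ) * g !₂[r, r] ^ 2 * L r ^ κ) atTop atTop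
  limit : ∃ ε : ℝ, 0 < ε ∧ ∃ gs : Plane → ℝ,
    TendstoUniformlyOn (fun (r : ℝ) (p : Plane) => g (r • p) / g !₂[r, r]) gs atTop
      ((1 + ε) • Δ) ∧
    IntegrableOn (fun q : Plane × Plane => |gs q.1 * gs q.2| / ‖q.1 - q.2‖ ^ (κ * α))
      (((1 + ε) • Δ) ×ˢ ((1 + ε) • Δ)) ∧
    -- the limit weight is continuous almost everywhere on the enlarged window
    (∀ᵐ p ∂(volume.restrict ((1 + ε) • Δ)), ContinuousWithinAt gs ((1 + ε) • Δ) p) ∧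
    -- the enlarged window surrounds the window, or the weight is nondegenerate on the diagonal
    (Δ ⊆ interior ((1 + ε) • Δ) ∨
      ∃ t : ℝ, 0 < t ∧ t < 1 ∧ !₂[t, t] ∈ (1 + ε) • Δ ∧ gs !₂[t, t] ≠ 0)

/-! Both functionals are integrals over one fixed ball. The change of variables p = r u, and the
fact that lattice cells have area one, write them as r² g(r,r) times the integral of a weight
against H_κ(ξ(·)), evaluated at r u for the integral and at the lower left lattice corner of r u for
the sum (`integralFunctional_eq`, `additiveFunctional_eq`).

For standard jointly Gaussian X, Y with correlation ρ, E H_κ(X) H_κ(Y) = κ! ρ^κ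
(`integral_hermiteFun_mul_hermiteFun`). Expanding the square therefore leaves three double integrals
with kernel B^κ: integral–integral, integral–sum and sum–sum. The kernel is regularly varying of
index -ακ > -2, and the evaluation points differ from r u by at most 2. So after division by B(r)^κ
all three tend to the same number I, the double integral of the limit weight over the window against
‖u - v‖^(-ακ) (`tendsto_integral_kernel`), and I - 2I + I = 0. The domination comes from Potter's
bound (`regularlyVarying_le`).

What remains is that the two rescaled weights have the same limit almost everywhere. For the sum
this needs the scaled lattice points to approach the window (`eventually_lattice_subset`), a null
frontier, and uniform convergence of the normalised weight on a neighbourhood of the window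
(`exists_limit_near`). -/

/-! ### Hermite polynomials of Gaussian variables. -/

open Polynomial in
/-- Hermite polynomials form an Appell sequence. -/
theorem derivative_hermite_succ (n : ℕ) :
    derivative (hermite (n + 1)) = ((n : ℤ[X]) + 1) * hermite n := by
  induction n with
  | zero => simp [hermite_succ]
  | succ n ih =>
    rw [hermite_succ (n + 1), derivative_sub, derivative_mul, ih, derivative_mul,
      hermite_succ n]
    simp
    ring

theorem integrable_eval_gaussianReal (m : ℝ) (v : NNReal) (p : Polynomial ℝ) :
    Integrable (fun x => p.eval x) (gaussianReal m v) := by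
  induction p using Polynomial.induction_on' with
  | add p q hp hq =>
    simp only [Polynomial.eval_add]
    exact hp.add hq
  | monomial n c =>
    simp only [Polynomial.eval_monomial]
    refine Integrable.const_mul ?_ c
    have := (memLp_id_gaussianReal (μ := m) (v := v) n).integrable_norm_pow'
    refine (integrable_norm_iff (by fun_prop)).1 ?_
    simpa using this

/-- Stein's identity: the standard Gaussian density φ satisfies φ' = -xφ, so this is integration by
parts with antiderivative -φ of xφ. -/
theorem integral_mul_eval_gaussianReal (p : Polynomial ℝ) :
    ∫ x, x * p.eval x ∂(gaussianReal 0 1) = ∫ x, p.derivative.eval x ∂(gaussianReal 0 1) := by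
  have hint : ∀ q : Polynomial ℝ, Integrable (fun x => q.eval x * gaussianPDFReal 0 1 x) := by
    intro q
    have h := integrable_eval_gaussianReal 0 1 q
    rw [gaussianReal_of_var_ne_zero _ one_ne_zero,
      integrable_withDensity_iff_integrable_smul' (measurable_gaussianPDF _ _)
        (ae_of_all _ fun _ => gaussianPDF_lt_top)] at h
    refine h.congr (ae_of_all _ fun x => ?_)
    simp [mul_comm]
  have hd : ∀ x : ℝ, HasDerivAt (fun x => -gaussianPDFReal 0 1 x)
      (x * gaussianPDFReal 0 1 x) x := by
    intro x
    unfold gaussianPDFReal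
    have h1 : HasDerivAt (fun x : ℝ => -(x - 0) ^ 2 / (2 * ((1 : NNReal) : ℝ))) (-x) x := by
      have := ((((hasDerivAt_id x).sub_const 0).pow 2).neg).div_const (2 * ((1 : NNReal) : ℝ))
      refine this.congr_deriv ?_
      simp
      ring
    refine ((h1.exp.const_mul ((√(2 * Real.pi * ((1 : NNReal) : ℝ)))⁻¹)).neg).congr_deriv ?_
    ring
  rw [integral_gaussianReal_eq_integral_smul one_ne_zero,
    integral_gaussianReal_eq_integral_smul one_ne_zero]
  have key := integral_mul_deriv_eq_deriv_mul_of_integrable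
    (u := fun x => p.eval x) (u' := fun x => p.derivative.eval x)
    (v := fun x => -gaussianPDFReal 0 1 x) (v' := fun x => x * gaussianPDFReal 0 1 x)
    (fun x _ => p.hasDerivAt x) (fun x _ => hd x)
    ((hint (p * Polynomial.X)).congr (ae_of_all _ fun x => by simp [mul_assoc]))
    ((hint p.derivative).neg.congr (ae_of_all _ fun x => by simp))
    ((hint p).neg.congr (ae_of_all _ fun x => by simp))
  simp only [mul_neg, integral_neg, neg_neg] at key
  calc _ = ∫ x, p.eval x * (x * gaussianPDFReal 0 1 x) := by
        congr 1; ext x; simp; ring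
    _ = _ := key
    _ = _ := by congr 1; ext x; simp; ring

section Gaussian

variable {Ω : Type*} [MeasurableSpace Ω] {μ : Measure Ω}

theorem memLp_two_eval_of_hasGaussianLaw {X : Ω → ℝ} (hX : HasGaussianLaw X μ)
    (p : Polynomial ℝ) : MemLp (fun ω => p.eval (X ω)) 2 μ := by
  have hm : AEStronglyMeasurable (fun ω => p.eval (X ω)) μ :=
    p.continuous.measurable.comp_aemeasurable hX.aemeasurable |>.aestronglyMeasurable
  rw [memLp_two_iff_integrable_sq hm]
  have h := integrable_eval_gaussianReal μ[X] Var[X; μ].toNNReal (p ^ 2)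
  rw [← hX.map_eq_gaussianReal] at h
  simp only [Polynomial.eval_pow] at h
  exact h.comp_aemeasurable hX.aemeasurable

theorem hermiteFun_eq_eval (n : ℕ) (x : ℝ) :
    hermiteFun n x = ((Polynomial.hermite n).map (algebraMap ℤ ℝ)).eval x := by
  rw [hermiteFun, Polynomial.eval_map_algebraMap]

theorem measurable_hermiteFun (n : ℕ) : Measurable (hermiteFun n) := by
  simp_rw [funext (hermiteFun_eq_eval n)]
  exact Polynomial.continuous _ |>.measurable

theorem memLp_two_hermiteFun {X : Ω → ℝ} (hX : HasGaussianLaw X μ) (n : ℕ) :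
    MemLp (fun ω => hermiteFun n (X ω)) 2 μ := by
  simp_rw [hermiteFun_eq_eval]
  exact memLp_two_eval_of_hasGaussianLaw hX _

variable [IsProbabilityMeasure μ]

/-- Gaussian integration by parts for polynomials in a pair of jointly Gaussian variables. -/
theorem integral_mul_eval_mul_eval {X Y : Ω → ℝ} {ρ : ℝ}
    (hXY : HasGaussianLaw (fun ω => (X ω, Y ω)) μ) (hX0 : μ[X] = 0)
    (hXX : ∫ ω, X ω * X ω ∂μ = 1) (hρ : ∫ ω, X ω * Y ω ∂μ = ρ) (p q : Polynomial ℝ) :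
    ∫ ω, X ω * p.eval (X ω) * q.eval (Y ω) ∂μ =
      ∫ ω, p.derivative.eval (X ω) * q.eval (Y ω) ∂μ +
        ρ * ∫ ω, p.eval (X ω) * q.derivative.eval (Y ω) ∂μ := by
  have hX := hXY.fst
  have hY := hXY.snd
  -- W is uncorrelated with X, hence independent of it by joint Gaussianity. With W = w frozen, Y =
  -- ρX + w is a function of X alone; Stein's identity applies and the chain rule produces the
  -- factor ρ.
  set W : Ω → ℝ := fun ω => Y ω - ρ * X ω with hWdef
  have hXW : HasGaussianLaw (fun ω => (X ω, W ω)) μ := by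
    have := hXY.map_fun ((ContinuousLinearMap.fst ℝ ℝ ℝ).prod
      (ContinuousLinearMap.snd ℝ ℝ ℝ - ρ • ContinuousLinearMap.fst ℝ ℝ ℝ))
    simpa [W] using this
  have hW := hXW.snd
  have iXY : Integrable (fun ω => X ω * Y ω) μ := hX.memLp_two.integrable_mul hY.memLp_two
  have iXX : Integrable (fun ω => X ω * X ω) μ := hX.memLp_two.integrable_mul hX.memLp_two
  have hind : IndepFun X W μ := by
    refine hXW.indepFun_of_covariance_eq_zero ?_
    rw [covariance_eq_sub hX.memLp_two hW.memLp_two, hX0, zero_mul, sub_zero]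
    have : (X * W) = fun ω => X ω * Y ω - ρ * (X ω * X ω) := by
      ext ω; simp [W]; ring
    rw [this, integral_sub iXY (iXX.const_mul _), integral_const_mul, hρ, hXX]
    ring
  have hlaw : μ.map X = gaussianReal 0 1 := by
    rw [hX.map_eq_gaussianReal, hX0, variance_eq_sub hX.memLp_two, hX0]
    have : μ[X ^ 2] = 1 := by rw [← hXX]; congr 1; ext ω; simp [sq]
    rw [this]
    simp
  have hjoint : μ.map (fun ω => (X ω, W ω)) = (gaussianReal 0 1).prod (μ.map W) := by
    rw [← hlaw]
    exact (indepFun_iff_map_prod_eq_prod_map_map hX.aemeasurable hW.aemeasurable).1 hind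
  have : IsProbabilityMeasure (μ.map W) := Measure.isProbabilityMeasure_map hW.aemeasurable
  have transfer : ∀ a b : Polynomial ℝ, Integrable (fun ω => a.eval (X ω) * b.eval (Y ω)) μ ∧
      Integrable (fun z : ℝ × ℝ => a.eval z.1 * b.eval (ρ * z.1 + z.2))
        ((gaussianReal 0 1).prod (μ.map W)) ∧
      ∫ ω, a.eval (X ω) * b.eval (Y ω) ∂μ =
        ∫ w, ∫ x, a.eval x * b.eval (ρ * x + w) ∂(gaussianReal 0 1) ∂(μ.map W) := by
    intro a b
    have h1 : Integrable (fun ω => a.eval (X ω) * b.eval (Y ω)) μ :=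
      (memLp_two_eval_of_hasGaussianLaw hX a).integrable_mul
        (memLp_two_eval_of_hasGaussianLaw hY b)
    have hm : Measurable (fun z : ℝ × ℝ => a.eval z.1 * b.eval (ρ * z.1 + z.2)) :=
      (a.continuous.measurable.comp measurable_fst).mul (b.continuous.measurable.comp (by fun_prop))
    have e : (fun ω => a.eval (X ω) * b.eval (Y ω)) =
        (fun z : ℝ × ℝ => a.eval z.1 * b.eval (ρ * z.1 + z.2)) ∘ fun ω => (X ω, W ω) := by
      ext ω; simp [W]
    have h2 : Integrable (fun z : ℝ × ℝ => a.eval z.1 * b.eval (ρ * z.1 + z.2))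
        ((gaussianReal 0 1).prod (μ.map W)) := by
      rw [← hjoint]
      exact (integrable_map_measure hm.aestronglyMeasurable hXW.aemeasurable).2 (e ▸ h1)
    refine ⟨h1, h2, ?_⟩
    rw [← integral_prod_symm _ h2, ← hjoint, integral_map hXW.aemeasurable
      hm.aestronglyMeasurable]
    exact congrArg (fun f => ∫ ω, f ω ∂μ) e
  have e0 : ∫ ω, X ω * p.eval (X ω) * q.eval (Y ω) ∂μ =
      ∫ ω, (Polynomial.X * p).eval (X ω) * q.eval (Y ω) ∂μ := by simp
  rw [e0, (transfer _ _).2.2, (transfer _ _).2.2, (transfer _ _).2.2, ← integral_const_mul,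
    ← integral_add (transfer _ _).2.1.integral_prod_right
      ((transfer _ _).2.1.integral_prod_right.const_mul _)]
  congr 1
  ext w
  have lin : ∀ x, (Polynomial.C ρ * Polynomial.X + Polynomial.C w).eval x = ρ * x + w := by simp
  have key := integral_mul_eval_gaussianReal
    (p * q.comp (Polynomial.C ρ * Polynomial.X + Polynomial.C w))
  have gi : ∀ a b : Polynomial ℝ,
      Integrable (fun x => a.eval x * b.eval (ρ * x + w)) (gaussianReal 0 1) := by
    intro a b
    have := integrable_eval_gaussianReal 0 1
      (a * b.comp (Polynomial.C ρ * Polynomial.X + Polynomial.C w))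
    simpa using this
  rw [← integral_const_mul, ← integral_add (gi _ _) ((gi _ _).const_mul _)]
  simp only [Polynomial.eval_mul, Polynomial.eval_comp, lin, Polynomial.derivative_mul,
    Polynomial.derivative_comp, Polynomial.eval_add, Polynomial.eval_X] at key ⊢
  convert key using 2
  · ext x; ring
  · ext x; simp; ring

/-- Write H_{n+1}(X) = X H_n(X) - H_n'(X) and integrate the first term by parts, keeping H_{n+1}(Y).
The terms with H_n'(X) cancel, and H_{n+1}' = (n+1) H_n leaves ρ (n+1) E H_n(X) H_n(Y). -/
theorem integral_hermiteFun_mul_hermiteFun {X Y : Ω → ℝ} {ρ : ℝ}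
    (hXY : HasGaussianLaw (fun ω => (X ω, Y ω)) μ) (hX0 : μ[X] = 0)
    (hXX : ∫ ω, X ω * X ω ∂μ = 1) (hρ : ∫ ω, X ω * Y ω ∂μ = ρ) (n : ℕ) :
    ∫ ω, hermiteFun n (X ω) * hermiteFun n (Y ω) ∂μ = n.factorial * ρ ^ n := by
  induction n with
  | zero => simp [hermiteFun]
  | succ n ih =>
    set H : ℕ → Polynomial ℝ := fun n => (Polynomial.hermite n).map (algebraMap ℤ ℝ) with hH
    have hs : H (n + 1) = Polynomial.X * H n - (H n).derivative := by
      simp [H, Polynomial.hermite_succ, Polynomial.derivative_map]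
    have hd : (H (n + 1)).derivative = ((n : Polynomial ℝ) + 1) * H n := by
      simp only [H, Polynomial.derivative_map, derivative_hermite_succ]
      simp
    have hi : ∀ a b : Polynomial ℝ, Integrable (fun ω => a.eval (X ω) * b.eval (Y ω)) μ :=
      fun a b => (memLp_two_eval_of_hasGaussianLaw hXY.fst a).integrable_mul
        (memLp_two_eval_of_hasGaussianLaw hXY.snd b)
    have key := integral_mul_eval_mul_eval hXY hX0 hXX hρ (H n) (H (n + 1))
    have e : ∫ ω, hermiteFun (n + 1) (X ω) * hermiteFun (n + 1) (Y ω) ∂μ =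
        ∫ ω, X ω * (H n).eval (X ω) * (H (n + 1)).eval (Y ω) ∂μ -
          ∫ ω, (H n).derivative.eval (X ω) * (H (n + 1)).eval (Y ω) ∂μ := by
      rw [← integral_sub _ (hi _ _)]
      · congr 1
        ext ω
        rw [hermiteFun_eq_eval, hermiteFun_eq_eval]
        change (H (n + 1)).eval (X ω) * (H (n + 1)).eval (Y ω) = _
        conv_lhs => arg 1; rw [hs]
        simp
        ring
      · refine (hi (Polynomial.X * H n) (H (n + 1))).congr (ae_of_all _ fun ω => ?_)
        simp
    rw [e, key, hd]
    have e2 : ∫ ω, (H n).eval (X ω) * (((n : Polynomial ℝ) + 1) * H n).eval (Y ω) ∂μ =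
        (n + 1) * ∫ ω, hermiteFun n (X ω) * hermiteFun n (Y ω) ∂μ := by
      rw [← integral_const_mul]
      congr 1
      ext ω
      simp [hermiteFun_eq_eval, H]
      ring
    rw [e2, ih, Nat.factorial_succ]
    push_cast
    ring

end Gaussian

/-! ### Slowly and regularly varying functions. -/

/-- Uniform convergence theorem for slowly varying functions, in additive form along sequences. -/
theorem tendsto_sub_of_slowlyVarying_additive {h : ℝ → ℝ} (hm : Measurable h)
    (hh : ∀ u : ℝ, Tendsto (fun x => h (x + u) - h x) atTop (𝓝 0)) {x u : ℕ → ℝ}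
    (hx : Tendsto x atTop atTop) (hu : ∀ n, u n ∈ Set.Icc (0 : ℝ) 1) :
    Tendsto (fun n => h (x n + u n) - h (x n)) atTop (𝓝 0) := by
  have inMeasure : ∀ (z : ℕ → ℝ), Tendsto z atTop atTop → ∀ ε : ℝ, 0 < ε →
      Tendsto (fun n => volume.restrict (Set.Icc (0 : ℝ) 4)
        {y | ENNReal.ofReal ε ≤ edist (h (z n + y) - h (z n)) 0}) atTop (𝓝 0) := by
    intro z hz ε hε
    have := tendstoInMeasure_of_tendsto_ae (μ := volume.restrict (Set.Icc (0 : ℝ) 4))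
      (f := fun n y => h (z n + y) - h (z n)) (g := fun _ => (0 : ℝ))
      (fun n => ((hm.comp (measurable_const.add measurable_id)).sub_const _).aestronglyMeasurable)
      (ae_of_all _ fun y => (hh y).comp hz)
    exact this _ (by simpa using hε)
  have hxu : Tendsto (fun n => x n + u n) atTop atTop :=
    tendsto_atTop_mono (fun n => le_add_of_nonneg_right (hu n).1) hx
  rw [Metric.tendsto_atTop']
  intro ε hε
  have h1 := (inMeasure x hx (ε / 2) (by positivity)).eventually (gt_mem_nhds zero_lt_one)
  have h2 := (inMeasure _ hxu (ε / 2) (by positivity)).eventually (gt_mem_nhds zero_lt_one)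
  obtain ⟨N, hN⟩ := eventually_atTop.1 (h1.and h2)
  refine ⟨N, fun n hn => ?_⟩
  obtain ⟨hA, hB⟩ := hN n hn.le
  set A := {y | ENNReal.ofReal (ε / 2) ≤ edist (h (x n + y) - h (x n)) 0}
  set A' := {y | ENNReal.ofReal (ε / 2) ≤ edist (h (x n + u n + y) - h (x n + u n)) 0}
  -- For large n the bad shifts from x n and from x n + u n each have measure below 1, so they
  -- cannot cover [1, 4], of length 3. A good y reaches the same point x n + y from both base
  -- points. Starting at 1 keeps y - u n inside [0, 4].
  have hnot : ¬ (Set.Icc (1 : ℝ) 4 ⊆ (A ∩ Set.Icc 0 4) ∪ (fun y => y - u n) ⁻¹' (A' ∩ Set.Icc 0 4)) := by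
    intro hsub
    have hmu := measure_mono (μ := (volume : Measure ℝ)) hsub
    have h3 : volume ((A ∩ Set.Icc 0 4) ∪ (fun y => y - u n) ⁻¹' (A' ∩ Set.Icc 0 4)) ≤ 1 + 1 := by
      refine (measure_union_le _ _).trans (add_le_add ?_ ?_)
      · rw [← Measure.restrict_apply' measurableSet_Icc]; exact hA.le
      · simp only [sub_eq_add_neg]
        rw [measure_preimage_add_right, ← Measure.restrict_apply' measurableSet_Icc]; exact hB.le
    have h4 := hmu.trans h3
    rw [Real.volume_Icc, one_add_one_eq_two] at h4
    have : ENNReal.ofReal (4 - 1) ≤ ENNReal.ofReal 2 := by simpa using h4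
    rw [ENNReal.ofReal_le_ofReal_iff (by norm_num)] at this
    norm_num at this
  obtain ⟨y, hy, hyn⟩ := Set.not_subset.1 hnot
  rw [Set.mem_union, not_or] at hyn
  have hun := hu n
  have a1 : y ∉ A := fun hyA => hyn.1 ⟨hyA, by linarith [hy.1], hy.2⟩
  have a2 : y - u n ∉ A' := fun hyA => hyn.2
    ⟨hyA, by linarith [hy.1, hun.2], by linarith [hy.2, hun.1]⟩
  simp only [A, A', Set.mem_ofPred_eq, edist_dist, not_le, Real.dist_eq, sub_zero] at a1 a2
  rw [ENNReal.ofReal_lt_ofReal_iff (by positivity)] at a1 a2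
  have e : x n + u n + (y - u n) = x n + y := by ring
  rw [e] at a2
  rw [Real.dist_eq, sub_zero]
  rw [abs_lt] at *
  constructor <;> linarith

/-- Potter's bound, in additive form. -/
theorem potter_additive {h : ℝ → ℝ} (hm : Measurable h)
    (hh : ∀ u : ℝ, Tendsto (fun x => h (x + u) - h x) atTop (𝓝 0)) {η : ℝ} (hη : 0 < η) :
    ∃ X : ℝ, ∀ x y : ℝ, X ≤ x → X ≤ y → |h x - h y| ≤ η * (|x - y| + 1) := by
  obtain ⟨X, hX⟩ : ∃ X : ℝ, ∀ x, X ≤ x → ∀ u ∈ Set.Icc (0 : ℝ) 1, |h (x + u) - h x| ≤ η := by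
    by_contra! hcon
    choose x hx u hu hbad using fun n : ℕ => hcon n
    have := tendsto_sub_of_slowlyVarying_additive hm hh
      (tendsto_atTop_mono hx tendsto_natCast_atTop_atTop) hu
    obtain ⟨n, hn⟩ := (this.abs.eventually (gt_mem_nhds (by simpa using hη))).exists
    exact lt_asymm hn (hbad n)
  have step : ∀ n : ℕ, ∀ x, X ≤ x → ∀ u : ℝ, 0 ≤ u → u ≤ n → |h (x + u) - h x| ≤ η * (u + 1) := by
    intro n
    induction n with
    | zero =>
      intro x hx u h0 h1
      have : u = 0 := le_antisymm (by simpa using h1) h0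
      simp [this, hη.le]
    | succ n ih =>
      intro x hx u h0 h1
      rcases le_total u 1 with hu | hu
      · exact (hX x hx u ⟨h0, hu⟩).trans (by nlinarith)
      · have i1 := ih (x + 1) (by linarith) (u - 1) (by linarith)
          (by push_cast at h1; linarith)
        have i2 := hX x hx 1 (by simp)
        have e : x + 1 + (u - 1) = x + u := by ring
        rw [e] at i1
        rw [abs_le] at *
        constructor <;> nlinarith
  have pos : ∀ x, X ≤ x → ∀ y, x ≤ y → |h y - h x| ≤ η * ((y - x) + 1) := by
    intro x hx y hy
    obtain ⟨n, hn⟩ := exists_nat_ge (y - x)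
    simpa using step n x hx (y - x) (by linarith) hn
  refine ⟨X, fun x y hx hy => ?_⟩
  rcases le_total x y with hxy | hxy
  · rw [abs_sub_comm, abs_sub_comm x y, abs_of_nonneg (sub_nonneg.2 hxy)]
    exact pos x hx y hxy
  · rw [abs_of_nonneg (sub_nonneg.2 hxy)]
    exact pos y hy x hxy

namespace SlowlyVarying

theorem pow {L : ℝ → ℝ} (hL : SlowlyVarying L) (n : ℕ) : SlowlyVarying (fun t => L t ^ n) where
  measurable := hL.measurable.pow_const n
  pos t ht := pow_pos (hL.pos t ht) n
  tendsto t ht := by simpa [div_pow] using (hL.tendsto t ht).pow n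

/-- Potter's bound. -/
theorem potter {L : ℝ → ℝ} (hL : SlowlyVarying L) {η : ℝ} (hη : 0 < η) :
    ∃ T : ℝ, 1 ≤ T ∧ ∀ x y : ℝ, T ≤ x → T ≤ y →
      |Real.log (L x) - Real.log (L y)| ≤ η * (|Real.log (x / y)| + 1) := by
  have hm : Measurable fun x => Real.log (L (Real.exp x)) := by
    have : Measurable fun x : ℝ => (⟨Real.exp x, Real.exp_pos x⟩ : Set.Ioi (0 : ℝ)) :=
      Real.measurable_exp.subtype_mk
    exact Real.measurable_log.comp (hL.measurable.comp this)
  have hh : ∀ u : ℝ, Tendsto (fun x => Real.log (L (Real.exp (x + u))) -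
      Real.log (L (Real.exp x))) atTop (𝓝 0) := by
    intro u
    have h1 := ((hL.tendsto _ (Real.exp_pos u)).comp Real.tendsto_exp_atTop).log one_ne_zero
    rw [Real.log_one] at h1
    refine h1.congr fun x => ?_
    simp only [Function.comp]
    rw [Real.log_div (hL.pos _ (by positivity)).ne' (hL.pos _ (by positivity)).ne', add_comm x u,
      Real.exp_add]
  obtain ⟨X, hX⟩ := potter_additive hm hh hη
  refine ⟨max 1 (Real.exp X), le_max_left _ _, fun x y hx hy => ?_⟩
  have hx0 : 0 < x := lt_of_lt_of_le (by positivity) hx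
  have hy0 : 0 < y := lt_of_lt_of_le (by positivity) hy
  have := hX (Real.log x) (Real.log y)
    ((Real.le_log_iff_exp_le hx0).2 ((le_max_right _ _).trans hx))
    ((Real.le_log_iff_exp_le hy0).2 ((le_max_right _ _).trans hy))
  rwa [Real.exp_log hx0, Real.exp_log hy0, ← Real.log_div hx0.ne' hy0.ne'] at this

/-- Since s stays near s₀ > 0, |log s| + 1 is eventually at most a fixed M, and Potter's bound with
η = ε / (2M) makes the logarithmic increment smaller than ε. -/
theorem tendsto_of_tendsto {L : ℝ → ℝ} (hL : SlowlyVarying L) {s : ℝ → ℝ} {s₀ : ℝ} (hs₀ : 0 < s₀)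
    (hs : Tendsto s atTop (𝓝 s₀)) : Tendsto (fun r => L (r * s r) / L r) atTop (𝓝 1) := by
  have hpos : ∀ᶠ r in atTop, 0 < r ∧ 0 < s r ∧ s₀ / 2 < s r :=
    (eventually_gt_atTop 0).and ((hs.eventually (lt_mem_nhds hs₀)).and
      (hs.eventually (lt_mem_nhds (by linarith))))
  suffices h : Tendsto (fun r => Real.log (L (r * s r)) - Real.log (L r)) atTop (𝓝 0) by
    have := (Real.continuous_exp.tendsto 0).comp h
    rw [Real.exp_zero] at this
    refine this.congr' ?_
    filter_upwards [hpos] with r hr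
    simp only [Function.comp]
    have p1 := hL.pos _ (mul_pos hr.1 hr.2.1)
    have p2 := hL.pos _ hr.1
    rw [Real.exp_sub, Real.exp_log p1, Real.exp_log p2]
  have hlog : Tendsto (fun r => |Real.log (s r)|) atTop (𝓝 |Real.log s₀|) := (hs.log hs₀.ne').abs
  rw [Metric.tendsto_nhds]
  intro ε hε
  set M := |Real.log s₀| + 2 with hM
  have hM0 : 0 < M := by positivity
  obtain ⟨T, hT1, hT⟩ := hL.potter (η := ε / (2 * M)) (by positivity)
  filter_upwards [hpos, eventually_ge_atTop T, eventually_ge_atTop (2 * T / s₀),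
    hlog.eventually (gt_mem_nhds (lt_add_one _))] with r hr h1 h2 h3
  have h4 : T ≤ r * s r := by
    rw [div_le_iff₀ hs₀] at h2
    nlinarith [hr.1, hr.2.2]
  have := hT (r * s r) r h4 h1
  rw [mul_div_cancel_left₀ _ hr.1.ne'] at this
  rw [Real.dist_eq, sub_zero]
  refine lt_of_le_of_lt this ?_
  calc ε / (2 * M) * (|Real.log (s r)| + 1) ≤ ε / (2 * M) * M := by
        gcongr; rw [hM]; linarith
    _ = ε / 2 := by field_simp
    _ < ε := by linarith

end SlowlyVarying

/-- A bounded regularly varying function `K` of index `-β` satisfies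
`K (r s) ≤ C K (r) max(s, 1 / r) ^ (-γ)` on bounded sets of `s`, for every `γ > β`. -/
theorem regularlyVarying_le {K L : ℝ → ℝ} {β γ R : ℝ} (hL : SlowlyVarying L)
    (hK : ∀ t, 0 < t → K t = t ^ (-β) * L t) (hK1 : ∀ t, 0 ≤ t → K t ≤ 1) (hβγ : β < γ)
    (hγ : 0 ≤ γ) :
    ∃ C r₀ : ℝ, 0 < C ∧ 0 < r₀ ∧ ∀ r, r₀ ≤ r → ∀ s, 0 ≤ s → s ≤ R →
      K (r * s) / K r ≤ C * max s (1 / r) ^ (-γ) := by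
  have hη : 0 < γ - β := by linarith
  obtain ⟨T, hT1, hT⟩ := hL.potter hη
  have hT0 : 0 < T := by linarith
  have hLT := hL.pos T hT0
  set η := γ - β with hηdef
  set R' := max 1 R with hR'
  have hR'1 : 1 ≤ R' := le_max_left _ _
  set C₁ := Real.exp (η * (2 * Real.log R' + 1)) with hC₁
  set C₂ := (L T * T ^ η * Real.exp (-η))⁻¹ * T ^ γ with hC₂
  refine ⟨C₁ + C₂, T, by positivity, hT0, fun r hr s hs0 hsR => ?_⟩
  have hr0 : 0 < r := by linarith
  have hLr := hL.pos r hr0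
  have hKr : 0 < K r := by rw [hK r hr0]; positivity
  -- If r s ≥ T, Potter's bound compares L (r s) with L r, and the margin γ - β absorbs the error.
  rcases le_or_gt T (r * s) with hrs | hrs
  · have hs : 0 < s := by
      by_contra hcon
      have : s = 0 := le_antisymm (not_lt.1 hcon) hs0
      rw [this, mul_zero] at hrs
      linarith
    have hmax : max s (1 / r) = s := by
      apply max_eq_left
      rw [div_le_iff₀ hr0]
      linarith [mul_comm r s]
    have hLrs := hL.pos (r * s) (by positivity)
    have h1 := (abs_le.1 (hT (r * s) r hrs hr)).2
    rw [mul_div_cancel_left₀ _ hr0.ne'] at h1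
    -- This one-sided form is available because s ≤ R' with R' ≥ 1; it turns the Potter factor into
    -- a constant times s ^ (-η), for large and small s at once.
    have h2 : |Real.log s| ≤ -Real.log s + 2 * Real.log R' := by
      have h3 : Real.log s ≤ Real.log R' := Real.log_le_log hs (hsR.trans (le_max_right _ _))
      have h4 : 0 ≤ Real.log R' := Real.log_nonneg hR'1
      rw [abs_le]
      constructor <;> linarith
    have h5 : L (r * s) ≤ L r * Real.exp (η * (-Real.log s + 2 * Real.log R' + 1)) := by
      rw [← Real.exp_log hLrs, ← Real.exp_log hLr, ← Real.exp_add]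
      apply Real.exp_le_exp.2
      have : η * (|Real.log s| + 1) ≤ η * (-Real.log s + 2 * Real.log R' + 1) := by gcongr
      linarith
    have h6 : Real.exp (η * (-Real.log s + 2 * Real.log R' + 1)) = C₁ * s ^ (-η) := by
      rw [hC₁, Real.rpow_def_of_pos hs, ← Real.exp_add]
      congr 1
      ring
    rw [h6] at h5
    rw [hmax, div_le_iff₀ hKr, hK r hr0, hK _ (by positivity), Real.mul_rpow hr0.le hs0]
    calc r ^ (-β) * s ^ (-β) * L (r * s) ≤ r ^ (-β) * s ^ (-β) * (L r * (C₁ * s ^ (-η))) := by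
          gcongr
      _ = C₁ * (s ^ (-β) * s ^ (-η)) * (r ^ (-β) * L r) := by ring
      _ = C₁ * s ^ (-γ) * (r ^ (-β) * L r) := by
          rw [← Real.rpow_add hs]; congr 3; rw [hηdef]; ring
      _ ≤ _ := by
          gcongr
          have : 0 < C₂ := by positivity
          linarith
  -- If r s < T, the numerator is only bounded by 1. Comparing L r with L T gives K r ≥ const · r ^
  -- (-γ), and max(s, 1/r) ≤ T / r, so the cutoff at 1/r suffices.
  · have h1 := (abs_le.1 (hT T r le_rfl hr)).2
    have hlog : |Real.log (T / r)| = Real.log r - Real.log T := by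
      rw [Real.log_div hT0.ne' hr0.ne', abs_of_nonpos]
      · ring
      · linarith [Real.log_le_log hT0 hr]
    rw [hlog] at h1
    have h2 : L T * T ^ η * Real.exp (-η) * r ^ (-η) ≤ L r := by
      rw [Real.rpow_def_of_pos hT0, Real.rpow_def_of_pos hr0]
      rw [← Real.exp_log hLT, ← Real.exp_log hLr, ← Real.exp_add, ← Real.exp_add, ← Real.exp_add]
      apply Real.exp_le_exp.2
      linarith
    have h3 : L T * T ^ η * Real.exp (-η) * r ^ (-γ) ≤ K r := by
      rw [hK r hr0]
      calc _ = r ^ (-β) * (L T * T ^ η * Real.exp (-η) * r ^ (-η)) := by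
            have : r ^ (-γ) = r ^ (-β) * r ^ (-η) := by
              rw [← Real.rpow_add hr0]; congr 1; rw [hηdef]; ring
            rw [this]; ring
        _ ≤ _ := by gcongr
    have hmax : max s (1 / r) ≤ T / r := by
      apply max_le
      · rw [le_div_iff₀ hr0]; linarith [mul_comm r s]
      · gcongr
    have hmax0 : 0 < max s (1 / r) := lt_max_of_lt_right (by positivity)
    have h4 : (T / r) ^ (-γ) ≤ max s (1 / r) ^ (-γ) :=
      Real.rpow_le_rpow_of_nonpos hmax0 hmax (by linarith)
    calc K (r * s) / K r ≤ 1 / (L T * T ^ η * Real.exp (-η) * r ^ (-γ)) := by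
          gcongr
          exact hK1 _ (by positivity)
      _ = C₂ * (T / r) ^ (-γ) := by
          rw [Real.div_rpow hT0.le hr0.le, hC₂, Real.rpow_neg hT0.le]
          field_simp
      _ ≤ (C₁ + C₂) * max s (1 / r) ^ (-γ) := by
          have : 0 < C₁ := by positivity
          gcongr
          linarith

/-! ### Second moments of Hermite functionals of the field. -/

namespace IsGaussianField

variable {Ω : Type*} [MeasurableSpace Ω] {μ : Measure Ω}
  {ξ : Plane → Ω → ℝ} {B : ℝ → ℝ}

theorem measurable_hermite_comp (hξ : IsGaussianField μ ξ B) (κ : ℕ) {β : Type*}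
    [MeasurableSpace β] {φ : β → Plane} (hφ : Measurable φ) :
    Measurable fun q : β × Ω => hermiteFun κ (ξ (φ q.1) q.2) :=
  (measurable_hermiteFun κ).comp
    (hξ.measurable.comp ((hφ.comp measurable_fst).prodMk measurable_snd))

/-- For points at distance t, E(ξ x - ξ 0)² = 2 - 2 B t is nonnegative. -/
theorem covariance_le_one (hξ : IsGaussianField μ ξ B) (hB : B 0 = 1) {t : ℝ} (ht : 0 ≤ t) :
    B t ≤ 1 := by
  set x : Plane := EuclideanSpace.single 0 t
  have hx : ‖x - 0‖ = t := by simp [x, abs_of_nonneg ht]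
  have m : ∀ p, MemLp (ξ p) 2 μ := fun p => (hξ.gaussian.hasGaussianLaw_eval p).memLp_two
  have h : 0 ≤ ∫ ω, (ξ x ω - ξ 0 ω) ^ 2 ∂μ := integral_nonneg fun ω => sq_nonneg _
  have i : ∀ p q, Integrable (fun ω => ξ p ω * ξ q ω) μ := fun p q => (m p).integrable_mul (m q)
  have e : ∫ ω, (ξ x ω - ξ 0 ω) ^ 2 ∂μ = B 0 - 2 * B t + B 0 := by
    have c1 := hξ.covariance x x
    have c2 := hξ.covariance x 0
    have c3 := hξ.covariance 0 0
    rw [hx] at c2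
    simp only [sub_self, norm_zero] at c1 c3
    have e1 : ∫ ω, (ξ x ω - ξ 0 ω) ^ 2 ∂μ =
        ∫ ω, (ξ x ω * ξ x ω - 2 * (ξ x ω * ξ 0 ω) + ξ 0 ω * ξ 0 ω) ∂μ := by
      congr 1
      ext ω
      ring
    have e2 := integral_add ((i x x).sub ((i x 0).const_mul 2)) (i 0 0)
    have e3 := integral_sub (i x x) ((i x 0).const_mul 2)
    simp only [Pi.sub_apply] at e2
    rw [e1, e2, e3, integral_const_mul, c1, c2, c3]
  rw [e, hB] at h
  linarith

theorem memLp_hermite (hξ : IsGaussianField μ ξ B) (κ : ℕ) (x : Plane) :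
    MemLp (fun ω => hermiteFun κ (ξ x ω)) 2 μ :=
  memLp_two_hermiteFun (hξ.gaussian.hasGaussianLaw_eval x) κ

variable [IsProbabilityMeasure μ]

theorem integral_hermiteFun_mul (hξ : IsGaussianField μ ξ B) (hB : B 0 = 1) (κ : ℕ)
    (x y : Plane) :
    ∫ ω, hermiteFun κ (ξ x ω) * hermiteFun κ (ξ y ω) ∂μ = κ.factorial * B ‖x - y‖ ^ κ :=
  integral_hermiteFun_mul_hermiteFun hξ.gaussian.hasGaussianLaw_prodMk (hξ.mean_zero x)
    (by simpa [hB] using hξ.covariance x x) (hξ.covariance x y) κ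

theorem integral_abs_hermite_mul_le (hξ : IsGaussianField μ ξ B) (hB : B 0 = 1) (κ : ℕ)
    (x y : Plane) :
    ∫ ω, |hermiteFun κ (ξ x ω) * hermiteFun κ (ξ y ω)| ∂μ ≤ κ.factorial := by
  have i : ∀ p q, Integrable (fun ω => hermiteFun κ (ξ p ω) * hermiteFun κ (ξ q ω)) μ :=
    fun p q => (hξ.memLp_hermite κ p).integrable_mul (hξ.memLp_hermite κ q)
  have e : ∀ p, ∫ ω, hermiteFun κ (ξ p ω) * hermiteFun κ (ξ p ω) ∂μ = κ.factorial := by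
    intro p
    simpa [hB] using hξ.integral_hermiteFun_mul hB κ p p
  calc _ ≤ ∫ ω, (hermiteFun κ (ξ x ω) * hermiteFun κ (ξ x ω) +
          hermiteFun κ (ξ y ω) * hermiteFun κ (ξ y ω)) / 2 ∂μ := by
        refine integral_mono (i x y).abs (((i x x).add (i y y)).div_const 2) fun ω => ?_
        simp only [abs_mul]
        nlinarith [sq_nonneg (|hermiteFun κ (ξ x ω)| - |hermiteFun κ (ξ y ω)|),
          abs_mul_abs_self (hermiteFun κ (ξ x ω)), abs_mul_abs_self (hermiteFun κ (ξ y ω))]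
    _ = κ.factorial := by
        rw [integral_div, integral_add (i x x) (i y y), e, e]
        ring

/-- This justifies Fubini between space and probability: the expectation of the absolute value is at
most C · κ!, uniformly in the point, and ν is finite. -/
theorem integrable_mul_hermite_mul (hξ : IsGaussianField μ ξ B) (hB : B 0 = 1) (κ : ℕ)
    {β : Type*} [MeasurableSpace β] {ν : Measure β} [IsFiniteMeasure ν] {φ ψ : β → Plane}
    (hφ : Measurable φ) (hψ : Measurable ψ) {h : β → ℝ} (hh : AEStronglyMeasurable h ν) {C : ℝ}
    (hC : ∀ᵐ z ∂ν, |h z| ≤ C) :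
    Integrable (fun q : β × Ω => h q.1 *
      (hermiteFun κ (ξ (φ q.1) q.2) * hermiteFun κ (ξ (ψ q.1) q.2))) (ν.prod μ) := by
  have hm : AEStronglyMeasurable (fun q : β × Ω => h q.1 *
      (hermiteFun κ (ξ (φ q.1) q.2) * hermiteFun κ (ξ (ψ q.1) q.2))) (ν.prod μ) :=
    hh.comp_fst.mul ((hξ.measurable_hermite_comp κ hφ).mul
      (hξ.measurable_hermite_comp κ hψ)).aestronglyMeasurable
  rw [integrable_prod_iff hm]
  refine ⟨ae_of_all _ fun z => ?_, ?_⟩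
  · exact ((hξ.memLp_hermite κ (φ z)).integrable_mul (hξ.memLp_hermite κ (ψ z))).const_mul (h z)
  refine Integrable.of_bound hm.norm.integral_prod_right' (C * κ.factorial) ?_
  filter_upwards [hC] with z hz
  rw [Real.norm_of_nonneg (integral_nonneg fun _ => norm_nonneg _)]
  simp only [norm_mul _ (hermiteFun _ _ * _), Real.norm_eq_abs]
  rw [integral_const_mul]
  have := hξ.integral_abs_hermite_mul_le hB κ (φ z) (ψ z)
  exact mul_le_mul hz this (integral_nonneg fun _ => abs_nonneg _) ((abs_nonneg _).trans hz)

/-- The second moments of weighted integrals of the Hermite functional of the field. -/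
theorem integral_mul_integral (hξ : IsGaussianField μ ξ B) (hB : B 0 = 1) (κ : ℕ)
    {β : Type*} [MeasurableSpace β] {ν : Measure β} [IsFiniteMeasure ν] {φ ψ : β → Plane}
    (hφ : Measurable φ) (hψ : Measurable ψ) {h k : β → ℝ} (hh : Measurable h)
    (hk : Measurable k) {C D : ℝ} (hC : ∀ᵐ z ∂ν, |h z| ≤ C) (hD : ∀ᵐ z ∂ν, |k z| ≤ D) :
    Integrable (fun ω => (∫ z, h z * hermiteFun κ (ξ (φ z) ω) ∂ν) *
      ∫ z, k z * hermiteFun κ (ξ (ψ z) ω) ∂ν) μ ∧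
    ∫ ω, (∫ z, h z * hermiteFun κ (ξ (φ z) ω) ∂ν) *
      (∫ z, k z * hermiteFun κ (ξ (ψ z) ω) ∂ν) ∂μ =
    κ.factorial * ∫ z, h z.1 * k z.2 * B ‖φ z.1 - ψ z.2‖ ^ κ ∂(ν.prod ν) := by
  have hbd : ∀ᵐ z ∂(ν.prod ν), |h z.1 * k z.2| ≤ C * D := by
    filter_upwards [Measure.quasiMeasurePreserving_fst.ae hC,
      Measure.quasiMeasurePreserving_snd.ae hD] with z h1 h2
    rw [abs_mul]
    exact mul_le_mul h1 h2 (abs_nonneg _) ((abs_nonneg _).trans h1)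
  have hP := hξ.integrable_mul_hermite_mul hB κ (ν := ν.prod ν) (hφ.comp measurable_fst)
    (hψ.comp measurable_snd) (h := fun z => h z.1 * k z.2)
    ((hh.comp measurable_fst).mul (hk.comp measurable_snd)).aestronglyMeasurable hbd
  have e : (fun ω => (∫ z, h z * hermiteFun κ (ξ (φ z) ω) ∂ν) *
      ∫ z, k z * hermiteFun κ (ξ (ψ z) ω) ∂ν) = fun ω => ∫ z, h z.1 * k z.2 *
        (hermiteFun κ (ξ (φ z.1) ω) * hermiteFun κ (ξ (ψ z.2) ω)) ∂(ν.prod ν) := by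
    ext ω
    rw [← integral_prod_mul]
    congr 1
    ext z
    ring
  rw [e]
  refine ⟨hP.integral_prod_right, ?_⟩
  rw [← integral_const_mul, ← integral_integral_swap hP]
  congr 1
  ext z
  rw [integral_const_mul, hξ.integral_hermiteFun_mul hB]
  ring

theorem memLp_integral (hξ : IsGaussianField μ ξ B) (hB : B 0 = 1) (κ : ℕ)
    {β : Type*} [MeasurableSpace β] {ν : Measure β} [IsFiniteMeasure ν] {φ : β → Plane}
    (hφ : Measurable φ) {h : β → ℝ} (hh : Measurable h) {C : ℝ} (hC : ∀ᵐ z ∂ν, |h z| ≤ C) :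
    MemLp (fun ω => ∫ z, h z * hermiteFun κ (ξ (φ z) ω) ∂ν) 2 μ := by
  have hm : AEStronglyMeasurable (fun ω => ∫ z, h z * hermiteFun κ (ξ (φ z) ω) ∂ν) μ := by
    have : Measurable fun q : β × Ω => h q.1 * hermiteFun κ (ξ (φ q.1) q.2) :=
      (hh.comp measurable_fst).mul (hξ.measurable_hermite_comp κ hφ)
    exact this.stronglyMeasurable.integral_prod_left'.aestronglyMeasurable
  rw [memLp_two_iff_integrable_sq hm]
  simpa only [sq] using (hξ.integral_mul_integral hB κ hφ hφ hh hh hC hC).1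

/-- Almost every path of H_κ(ξ) is square-integrable in space by Fubini, hence integrable over the
finite measure ν, and the bounded weight preserves this. -/
theorem ae_integrable_mul_hermite (hξ : IsGaussianField μ ξ B) (hB : B 0 = 1) (κ : ℕ)
    {β : Type*} [MeasurableSpace β] {ν : Measure β} [IsFiniteMeasure ν] {φ : β → Plane}
    (hφ : Measurable φ) {h : β → ℝ} (hh : Measurable h) {C : ℝ} (hC : ∀ᵐ z ∂ν, |h z| ≤ C) :
    ∀ᵐ ω ∂μ, Integrable (fun z => h z * hermiteFun κ (ξ (φ z) ω)) ν := by
  have hP := hξ.integrable_mul_hermite_mul hB κ (ν := ν) hφ hφ (h := fun _ => 1)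
    aestronglyMeasurable_const (ae_of_all _ fun _ => (abs_one (α := ℝ)).le)
  filter_upwards [hP.prod_left_ae] with ω hω
  have hm : AEStronglyMeasurable (fun z => hermiteFun κ (ξ (φ z) ω)) ν :=
    ((hξ.measurable_hermite_comp κ hφ).comp
      (measurable_id.prodMk measurable_const)).aestronglyMeasurable
  have h2 : MemLp (fun z => hermiteFun κ (ξ (φ z) ω)) 2 ν := by
    rw [memLp_two_iff_integrable_sq hm]
    simpa [sq] using hω
  exact (h2.integrable one_le_two).bdd_mul hh.aestronglyMeasurable hC

end IsGaussianField

/-! ### Scaling limit of double integrals with a regularly varying kernel. -/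

/-- Differences of points of the ball lie in a ball of radius 2R + 1, where ‖x‖ ^ (-γ) is
integrable; the double integral is then the convolution integrand of two integrable functions. -/
theorem integrable_norm_sub_rpow_closedBall {E : Type*} [NormedAddCommGroup E] [NormedSpace ℝ E]
    [FiniteDimensional ℝ E] [MeasurableSpace E] [BorelSpace E] (ν : Measure E)
    [ν.IsAddHaarMeasure] (hE : 1 ≤ Module.finrank ℝ E) {γ : ℝ} (hγ : γ < Module.finrank ℝ E)
    (R : ℝ) :
    Integrable (fun z : E × E => ‖z.1 - z.2‖ ^ (-γ))
      ((ν.restrict (Metric.closedBall 0 R)).prod (ν.restrict (Metric.closedBall 0 R))) := by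
  have hm : Measurable fun x : E => ‖x‖ ^ (-γ) := measurable_norm.pow_const _
  have h1 : IntegrableOn (fun x : E => ‖x‖ ^ (-γ)) (Metric.ball 0 (2 * R + 1)) ν := by
    refine integrableOn_ball_of_norm_le_rpow (C := 1) hE hγ (ae_of_all _ fun x => ?_)
      hm.aestronglyMeasurable
    rw [Real.norm_of_nonneg (by positivity), one_mul]
  rw [← integrable_indicator_iff measurableSet_ball] at h1
  have h2 : Integrable ((Metric.closedBall (0 : E) R).indicator fun _ => (1 : ℝ)) ν := by
    rw [integrable_indicator_iff measurableSet_closedBall]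
    exact integrableOn_const (measure_closedBall_lt_top.ne)
  have h3 := (h2.convolution_integrand (ContinuousLinearMap.mul ℝ ℝ) h1)
  rw [Measure.prod_restrict]
  refine (h3.restrict (s := Metric.closedBall 0 R ×ˢ Metric.closedBall 0 R)).congr ?_
  filter_upwards [ae_restrict_mem (measurableSet_closedBall.prod measurableSet_closedBall)]
    with z hz
  have h4 : z.1 - z.2 ∈ Metric.ball (0 : E) (2 * R + 1) := by
    rw [mem_ball_zero_iff]
    have a1 := mem_closedBall_zero_iff.1 hz.1
    have a2 := mem_closedBall_zero_iff.1 hz.2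
    linarith [norm_sub_le z.1 z.2]
  simp [Set.indicator_of_mem h4, Set.indicator_of_mem hz.2]

theorem ae_prod_ne {α : Type*} [MeasurableSpace α] [MeasurableSingletonClass α]
    [MeasurableEq α] (ν ν' : Measure α) [SFinite ν'] [NullSingletonClass ν'] :
    ∀ᵐ z : α × α ∂(ν.prod ν'), z.1 ≠ z.2 := by
  rw [ae_iff]
  simp only [not_not]
  change (ν.prod ν') (Set.diagonal α) = 0
  rw [Measure.measure_prod_null measurableSet_diagonal]
  refine ae_of_all _ fun x => ?_
  have : Prod.mk x ⁻¹' Set.diagonal α = {x} := by ext y; simp [eq_comm]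
  simp only [this, Pi.zero_apply]
  exact measure_singleton x

/-- Scaling limit of double integrals with a bounded regularly varying kernel. -/
theorem tendsto_integral_kernel {K L : ℝ → ℝ} {β : ℝ} (hL : SlowlyVarying L)
    (hK : ∀ t, 0 < t → K t = t ^ (-β) * L t) (hK0 : ∀ t, 0 ≤ t → 0 ≤ K t)
    (hK1 : ∀ t, 0 ≤ t → K t ≤ 1)
    (hKm : Measurable fun z : Plane × Plane => K ‖z.1 - z.2‖) (hβ0 : 0 ≤ β) (hβ : β < 2)
    {R : ℝ} {h k : ℝ → Plane → ℝ} {h' k' : Plane → ℝ} {φ ψ : ℝ → Plane → Plane}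
    {C D : ℝ} (hh : ∀ r, Measurable (h r)) (hk : ∀ r, Measurable (k r))
    (hφ : ∀ r, Measurable (φ r)) (hψ : ∀ r, Measurable (ψ r))
    (hφr : ∀ r u, ‖φ r u - r • u‖ ≤ 2) (hψr : ∀ r u, ‖ψ r u - r • u‖ ≤ 2)
    (hC : ∀ᶠ r in atTop, ∀ u, |h r u| ≤ C) (hD : ∀ᶠ r in atTop, ∀ u, |k r u| ≤ D)
    (hlim : ∀ᵐ u ∂(volume : Measure Plane), Tendsto (fun r => h r u) atTop (𝓝 (h' u)))
    (klim : ∀ᵐ u ∂(volume : Measure Plane), Tendsto (fun r => k r u) atTop (𝓝 (k' u))) :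
    Tendsto (fun r => (∫ z, h r z.1 * k r z.2 * K ‖φ r z.1 - ψ r z.2‖
        ∂((volume.restrict (Metric.closedBall 0 R)).prod
          (volume.restrict (Metric.closedBall 0 R)))) / K r) atTop
      (𝓝 (∫ z, h' z.1 * k' z.2 * ‖z.1 - z.2‖ ^ (-β)
        ∂((volume.restrict (Metric.closedBall 0 R)).prod
          (volume.restrict (Metric.closedBall 0 R))))) := by
  set ν : Measure Plane := volume.restrict (Metric.closedBall 0 R) with hν
  -- Potter's bound needs γ > β, and local integrability of ‖·‖ ^ (-γ) in the plane needs γ < 2.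
  obtain ⟨γ, hβγ, hγ⟩ := exists_between hβ
  have hγ0 : 0 < γ := lt_of_le_of_lt hβ0 hβγ
  obtain ⟨A, r₀, hA, hr₀, hbound⟩ := regularlyVarying_le (R := 2 * R + 4) hL hK hK1 hβγ hγ0.le
  have hdiff : ∀ (r : ℝ) (u v : Plane), |‖φ r u - ψ r v‖ - ‖r • u - r • v‖| ≤ 4 := by
    intro r u v
    refine (abs_norm_sub_norm_le _ _).trans ?_
    have : φ r u - ψ r v - (r • u - r • v) = (φ r u - r • u) - (ψ r v - r • v) := by abel
    rw [this]
    linarith [norm_sub_le (φ r u - r • u) (ψ r v - r • v), hφr r u, hψr r v]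
  have hs : ∀ r : ℝ, 0 < r → ∀ u v : Plane, |‖φ r u - ψ r v‖ / r - ‖u - v‖| ≤ 4 / r := by
    intro r hr u v
    have := hdiff r u v
    rw [← smul_sub, norm_smul, Real.norm_of_nonneg hr.le] at this
    have e : ‖φ r u - ψ r v‖ / r - ‖u - v‖ = (‖φ r u - ψ r v‖ - r * ‖u - v‖) / r := by
      field_simp
    rw [e, abs_div, abs_of_pos hr]
    gcongr
  simp_rw [← integral_div]
  have hfin : Module.finrank ℝ Plane = 2 := by simp
  refine tendsto_integral_filter_of_dominated_convergence
    (fun z => C * D * (A * (5 ^ γ * ‖z.1 - z.2‖ ^ (-γ)))) (Eventually.of_forall fun r => ?_) ?_ ?_ ?_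
  · refine Measurable.aestronglyMeasurable ?_
    exact ((((hh r).comp measurable_fst).mul ((hk r).comp measurable_snd)).mul
      (hKm.comp (((hφ r).comp measurable_fst).prodMk ((hψ r).comp measurable_snd)))).div_const _
  · filter_upwards [eventually_ge_atTop r₀, eventually_ge_atTop 1, hC, hD] with r hr hr1 hCr hDr
    have hr0 : 0 < r := by linarith
    have hball : ∀ᵐ z ∂(ν.prod ν),
        z ∈ Metric.closedBall (0 : Plane) R ×ˢ Metric.closedBall (0 : Plane) R := by
      rw [hν, Measure.prod_restrict]
      exact ae_restrict_mem (measurableSet_closedBall.prod measurableSet_closedBall)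
    filter_upwards [hball, ae_prod_ne ν ν] with z hz hne
    have hd : 0 < ‖z.1 - z.2‖ := norm_pos_iff.2 (sub_ne_zero.2 hne)
    have hsz := hs r hr0 z.1 z.2
    set s := ‖φ r z.1 - ψ r z.2‖ / r with hsdef
    have hs0 : 0 ≤ s := by positivity
    have hrs : ‖φ r z.1 - ψ r z.2‖ = r * s := by rw [hsdef]; field_simp
    have h4r : 4 / r ≤ 4 := div_le_self (by norm_num) hr1
    have a1 := mem_closedBall_zero_iff.1 hz.1
    have a2 := mem_closedBall_zero_iff.1 hz.2
    have hsR : s ≤ 2 * R + 4 := by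
      linarith [(abs_le.1 hsz).2, norm_sub_le z.1 z.2]
    have hb := hbound r hr s hs0 hsR
    have hm0 : 0 < max s (1 / r) := lt_max_of_lt_right (by positivity)
    -- Each evaluation point is off by at most 2, so ‖u - v‖ ≤ s + 4/r ≤ 5 max(s, 1/r). This
    -- replaces the r-dependent cutoff by a fixed singularity.
    have hdm : ‖z.1 - z.2‖ / 5 ≤ max s (1 / r) := by
      have h1 := le_max_left s (1 / r)
      have h2 := le_max_right s (1 / r)
      have h3 : 4 / r = 4 * (1 / r) := by ring
      linarith [(abs_le.1 hsz).1]
    have hrp : max s (1 / r) ^ (-γ) ≤ 5 ^ γ * ‖z.1 - z.2‖ ^ (-γ) := by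
      refine (Real.rpow_le_rpow_of_nonpos (by positivity) hdm (by linarith)).trans (le_of_eq ?_)
      rw [Real.div_rpow hd.le (by norm_num), Real.rpow_neg (by norm_num : (0 : ℝ) ≤ 5),
        div_inv_eq_mul, mul_comm]
    have hKq : 0 ≤ K (r * s) / K r := div_nonneg (hK0 _ (by positivity)) (hK0 _ hr0.le)
    rw [hrs, mul_div_assoc, norm_mul, Real.norm_of_nonneg hKq, norm_mul]
    have hC0 : 0 ≤ C := (abs_nonneg _).trans (hCr 0)
    have hD0 : 0 ≤ D := (abs_nonneg _).trans (hDr 0)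
    gcongr
    · exact hCr z.1
    · exact hDr z.2
    · exact hb.trans (by gcongr)
  · exact (((integrable_norm_sub_rpow_closedBall volume (by simp [hfin])
      (by simpa [hfin] using hγ) R).const_mul _).const_mul _).const_mul _
  · have hν' : ν ≪ volume := Measure.absolutelyContinuous_of_le Measure.restrict_le_self
    filter_upwards [Measure.quasiMeasurePreserving_fst.ae (hν'.ae_le hlim),
      Measure.quasiMeasurePreserving_snd.ae (hν'.ae_le klim), ae_prod_ne ν ν] with z h1 h2 hne
    have hd : 0 < ‖z.1 - z.2‖ := norm_pos_iff.2 (sub_ne_zero.2 hne)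
    have hst : Tendsto (fun r => ‖φ r z.1 - ψ r z.2‖ / r) atTop (𝓝 ‖z.1 - z.2‖) := by
      rw [tendsto_iff_dist_tendsto_zero]
      refine squeeze_zero' (Eventually.of_forall fun _ => dist_nonneg) ?_
        (tendsto_const_nhds.div_atTop tendsto_id : Tendsto (fun r : ℝ => 4 / r) atTop (𝓝 0))
      filter_upwards [eventually_gt_atTop 0] with r hr
      exact hs r hr z.1 z.2
    have hKlim : Tendsto (fun r => K ‖φ r z.1 - ψ r z.2‖ / K r) atTop
        (𝓝 (‖z.1 - z.2‖ ^ (-β))) := by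
      have h3 := (hst.rpow_const (p := -β) (Or.inl hd.ne')).mul (hL.tendsto_of_tendsto hd hst)
      rw [mul_one] at h3
      refine h3.congr' ?_
      filter_upwards [eventually_gt_atTop 0, hst.eventually (lt_mem_nhds hd)] with r hr hsr
      have hrs : ‖φ r z.1 - ψ r z.2‖ = r * (‖φ r z.1 - ψ r z.2‖ / r) := by field_simp
      conv_rhs => rw [hrs]
      have := hL.pos r hr
      rw [hK r hr, hK _ (mul_pos hr hsr), Real.mul_rpow hr.le hsr.le]
      have : r ^ (-β) ≠ 0 := by positivity
      field_simp
    simpa only [mul_div_assoc] using (h1.mul h2).mul hKlim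

/-! ### Lattice sums as integrals over unit cells. -/

/-- The lower left corner of the unit lattice cell of a point. -/
noncomputable def cellCorner (x : Plane) : Plane := !₂[(⌊x 0⌋ : ℝ), (⌊x 1⌋ : ℝ)]

/-- The union of the unit lattice cells whose lower left corners are summed over by
`additiveFunctional`. -/
def latticeWindow (a b : ℝ) (fl fu : ℝ → ℝ) (r : ℝ) : Set Plane :=
  {x | ⌊x 0⌋ ∈ Finset.Icc ⌊a * r⌋ ⌈b * r⌉ ∧ ⌊x 1⌋ ∈ columnRows a b fl fu r ⌊x 0⌋}

theorem plane_norm_le (x : Plane) : ‖x‖ ≤ |x 0| + |x 1| := by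
  rw [EuclideanSpace.norm_eq, Fin.sum_univ_two]
  apply Real.sqrt_le_iff.2
  refine ⟨by positivity, ?_⟩
  simp only [Real.norm_eq_abs]
  nlinarith [abs_nonneg (x 0), abs_nonneg (x 1)]

theorem measurable_cellCorner : Measurable cellCorner := by
  unfold cellCorner
  refine (WithLp.measurable_toLp 2 _).comp (measurable_pi_iff.2 fun i => ?_)
  have hfl : ∀ j : Fin 2, Measurable fun x : Plane => ((⌊x j⌋ : ℤ) : ℝ) := by
    intro j
    have : Measurable fun x : Plane => x j := by fun_prop
    exact (measurable_from_top.comp (Int.measurable_floor.comp this))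
  fin_cases i
  · exact hfl 0
  · exact hfl 1

theorem norm_cellCorner_sub_le (x : Plane) : ‖cellCorner x - x‖ ≤ 2 := by
  refine (plane_norm_le _).trans ?_
  have h : ∀ t : ℝ, |(⌊t⌋ : ℝ) - t| ≤ 1 := fun t => by
    rw [abs_le]
    constructor <;> linarith [Int.floor_le t, Int.lt_floor_add_one t]
  have h0 : (cellCorner x - x) 0 = (⌊x 0⌋ : ℝ) - x 0 := by simp [cellCorner]
  have h1 : (cellCorner x - x) 1 = (⌊x 1⌋ : ℝ) - x 1 := by simp [cellCorner]
  rw [h0, h1]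
  linarith [h (x 0), h (x 1)]

theorem measurableSet_latticeWindow (a b : ℝ) (fl fu : ℝ → ℝ) (r : ℝ) :
    MeasurableSet (latticeWindow a b fl fu r) := by
  have hf : Measurable fun x : Plane => (⌊x 0⌋, ⌊x 1⌋) := by
    have h0 : Measurable fun x : Plane => x 0 := by fun_prop
    have h1 : Measurable fun x : Plane => x 1 := by fun_prop
    exact (Int.measurable_floor.comp h0).prodMk (Int.measurable_floor.comp h1)
  exact hf (MeasurableSet.of_discrete
    (s := {p : ℤ × ℤ | p.1 ∈ Finset.Icc ⌊a * r⌋ ⌈b * r⌉ ∧ p.2 ∈ columnRows a b fl fu r p.1}))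

theorem volume_cell (i j : ℤ) : volume {x : Plane | ⌊x 0⌋ = i ∧ ⌊x 1⌋ = j} = 1 := by
  have e : {x : Plane | ⌊x 0⌋ = i ∧ ⌊x 1⌋ = j} = WithLp.ofLp ⁻¹'
      (Set.univ.pi fun k : Fin 2 => Set.Ico ((![i, j] k : ℤ) : ℝ) ((![i, j] k : ℤ) + 1)) := by
    ext x
    simp [Set.mem_pi, Fin.forall_fin_two, Int.floor_eq_iff]
  rw [e, (PiLp.volume_preserving_ofLp (Fin 2)).measure_preimage
    (MeasurableSet.univ_pi fun _ => measurableSet_Ico).nullMeasurableSet, Real.volume_pi_Ico]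
  simp

theorem measurableSet_cell (i j : ℤ) : MeasurableSet {x : Plane | ⌊x 0⌋ = i ∧ ⌊x 1⌋ = j} := by
  have h0 : Measurable fun x : Plane => x 0 := by fun_prop
  have h1 : Measurable fun x : Plane => x 1 := by fun_prop
  exact ((Int.measurable_floor.comp h0) (measurableSet_singleton i)).inter
    ((Int.measurable_floor.comp h1) (measurableSet_singleton j))

theorem sum_lattice_eq_integral (a b : ℝ) (fl fu : ℝ → ℝ) (r : ℝ) (s : Plane → ℝ) :
    ∑ i ∈ Finset.Icc ⌊a * r⌋ ⌈b * r⌉, ∑ j ∈ columnRows a b fl fu r i,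
      s !₂[(i : ℝ), (j : ℝ)] =
    ∫ x : Plane, (latticeWindow a b fl fu r).indicator (fun x => s (cellCorner x)) x := by
  have e : (latticeWindow a b fl fu r).indicator (fun x => s (cellCorner x)) = fun x =>
      ∑ i ∈ Finset.Icc ⌊a * r⌋ ⌈b * r⌉, ∑ j ∈ columnRows a b fl fu r i,
        {x : Plane | ⌊x 0⌋ = i ∧ ⌊x 1⌋ = j}.indicator (fun _ => s !₂[(i : ℝ), (j : ℝ)]) x := by
    ext x
    by_cases hx : x ∈ latticeWindow a b fl fu r
    · rw [Set.indicator_of_mem hx, Finset.sum_eq_single_of_mem _ hx.1,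
        Finset.sum_eq_single_of_mem _ hx.2]
      · simp [cellCorner]
      · intro j _ hj
        simp [hj.symm]
      · intro i _ hi
        simp [hi.symm]
    · rw [Set.indicator_of_notMem hx]
      refine (Finset.sum_eq_zero fun i hi => Finset.sum_eq_zero fun j hj => ?_).symm
      refine Set.indicator_of_notMem ?_ _
      rintro ⟨rfl, rfl⟩
      exact hx ⟨hi, hj⟩
  have hint : ∀ i j : ℤ, Integrable ({x : Plane | ⌊x 0⌋ = i ∧ ⌊x 1⌋ = j}.indicator
      (fun _ => s !₂[(i : ℝ), (j : ℝ)])) := fun i j => by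
    rw [integrable_indicator_iff (measurableSet_cell i j)]
    exact integrableOn_const (by simp [volume_cell])
  rw [e, integral_finsetSum _ fun i _ => integrable_finsetSum _ fun j _ => hint i j]
  refine Finset.sum_congr rfl fun i _ => ?_
  rw [integral_finsetSum _ fun j _ => hint i j]
  refine Finset.sum_congr rfl fun j _ => ?_
  rw [integral_indicator (measurableSet_cell i j)]
  simp [Measure.real, volume_cell]

theorem tendsto_cellCorner_smul (u : Plane) :
    Tendsto (fun r : ℝ => r⁻¹ • cellCorner (r • u)) atTop (𝓝 u) := by
  rw [tendsto_iff_norm_sub_tendsto_zero]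
  refine squeeze_zero' (Eventually.of_forall fun _ => norm_nonneg _) ?_
    (tendsto_const_nhds.div_atTop tendsto_id : Tendsto (fun r : ℝ => 2 / r) atTop (𝓝 0))
  filter_upwards [eventually_gt_atTop 0] with r hr
  have e : r⁻¹ • cellCorner (r • u) - u = r⁻¹ • (cellCorner (r • u) - r • u) := by
    rw [smul_sub, inv_smul_smul₀ hr.ne']
  rw [e, norm_smul, norm_inv, Real.norm_of_nonneg hr.le, div_eq_inv_mul]
  gcongr
  exact norm_cellCorner_sub_le _

/-! ### The discretised window approximates the window. -/

namespace IsWindow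

variable {Δ : Set Plane} {a b : ℝ} {fl fu : ℝ → ℝ}

theorem le_of_mem (hΔ : IsWindow Δ a b fl fu) {x : ℝ} (hx : x ∈ Set.Icc a b) : fl x ≤ fu x := by
  have h : ∀ p ∈ Δ, fl (p 0) ≤ fu (p 0) := fun p hp => by
    rw [hΔ.eq] at hp
    exact hp.2.2.1.trans hp.2.2.2
  rcases hx.1.eq_or_lt with rfl | h1
  · obtain ⟨p, hp, hpa⟩ := hΔ.left.1
    exact hpa ▸ h p hp
  · rcases hx.2.eq_or_lt with rfl | h2
    · obtain ⟨p, hp, hpa⟩ := hΔ.right.1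
      exact hpa ▸ h p hp
    · exact (hΔ.lt x h1 h2).le

theorem mk_mem (hΔ : IsWindow Δ a b fl fu) {x y : ℝ} (hx : x ∈ Set.Icc a b) (h1 : fl x ≤ y)
    (h2 : y ≤ fu x) : !₂[x, y] ∈ Δ := by
  rw [hΔ.eq]
  exact ⟨hx.1, hx.2, h1, h2⟩

theorem exists_abs_le (hΔ : IsWindow Δ a b fl fu) : ∃ M : ℝ, ∀ p ∈ Δ, ∀ i, |p i| ≤ M := by
  obtain ⟨M, hM⟩ := hΔ.isCompact.isBounded.exists_norm_le
  exact ⟨M, fun p hp i => (PiLp.norm_apply_le p i).trans (hM p hp)⟩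

/-- The points p and p' lie on the lower and upper graphs over the i-th column, where the infimum
and supremum are attained up to 1. Rounding loses another 1, hence 2 / r after rescaling. Two points
are needed because the graphs may jump within a column. -/
theorem exists_near (hΔ : IsWindow Δ a b fl fu) {r : ℝ} (hr : 0 < r) {i j : ℤ}
    (hj : j ∈ columnRows a b fl fu r i) :
    ∃ p ∈ Δ, ∃ p' ∈ Δ, |i / r - p 0| ≤ 2 / r ∧ |i / r - p' 0| ≤ 2 / r ∧
      p 1 - 2 / r ≤ j / r ∧ j / r ≤ p' 1 + 2 / r := by
  unfold columnRows at hj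
  split_ifs at hj with hne
  swap
  · simp at hj
  rw [Finset.mem_Icc] at hj
  have hbase : ∀ x ∈ columnBase a b r i, x / r ∈ Set.Icc a b ∧ |i / r - x / r| ≤ 2 / r := by
    intro x hx
    have hx2 := hx.2
    have hx1 : (i : ℝ) ≤ x ∧ x ≤ i + 1 := by
      have := hx.1
      split_ifs at this with h
      · exact ⟨this.1.le, this.2.trans h.2.le⟩
      · exact ⟨this.1, this.2.le⟩
    refine ⟨⟨(le_div_iff₀ hr).2 hx2.1, (div_le_iff₀ hr).2 hx2.2⟩, ?_⟩
    rw [← sub_div, abs_div, abs_of_pos hr]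
    gcongr
    rw [abs_le]
    constructor <;> linarith
  obtain ⟨_, ⟨x, hx, rfl⟩, hxl⟩ := exists_lt_of_csInf_lt (hne.image (dilated fl r))
    (lt_add_one (sInf (dilated fl r '' columnBase a b r i)))
  obtain ⟨_, ⟨x', hx', rfl⟩, hxu⟩ := exists_lt_of_lt_csSup (hne.image (dilated fu r))
    (sub_one_lt (sSup (dilated fu r '' columnBase a b r i)))
  have hj1 : sInf (dilated fl r '' columnBase a b r i) - 1 < j := by
    have h1 := Int.lt_floor_add_one (sInf (dilated fl r '' columnBase a b r i))
    have h2 : ((⌊sInf (dilated fl r '' columnBase a b r i)⌋ : ℤ) : ℝ) ≤ j := by exact_mod_cast hj.1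
    linarith
  have hj2 : (j : ℝ) < sSup (dilated fu r '' columnBase a b r i) + 1 := by
    have h1 := Int.ceil_lt_add_one (sSup (dilated fu r '' columnBase a b r i))
    have h2 : (j : ℝ) ≤ ((⌈sSup (dilated fu r '' columnBase a b r i)⌉ : ℤ) : ℝ) := by
      exact_mod_cast hj.2
    linarith
  obtain ⟨m1, n1⟩ := hbase x hx
  obtain ⟨m2, n2⟩ := hbase x' hx'
  unfold dilated at hxl hxu
  refine ⟨_, hΔ.mk_mem m1 le_rfl (hΔ.le_of_mem m1), _, hΔ.mk_mem m2 (hΔ.le_of_mem m2) le_rfl,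
    by simpa using n1, by simpa using n2, ?_, ?_⟩
  · rw [le_div_iff₀ hr, sub_mul, div_mul_cancel₀ _ hr.ne']
    simp only [Matrix.cons_val_one, Matrix.cons_val_fin_one]
    unfold dilated at hj1
    linarith [mul_comm r (fl (x / r))]
  · rw [div_le_iff₀ hr, add_mul, div_mul_cancel₀ _ hr.ne']
    simp only [Matrix.cons_val_one, Matrix.cons_val_fin_one]
    unfold dilated at hj2
    linarith [mul_comm r (fu (x' / r))]

/-- The summation points of the dilated window, scaled back, approach the window. -/
theorem eventually_lattice_subset (hΔ : IsWindow Δ a b fl fu) {U : Set Plane} (hU : IsOpen U)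
    (hΔU : Δ ⊆ U) :
    ∀ᶠ r : ℝ in atTop, ∀ x ∈ latticeWindow a b fl fu r, r⁻¹ • cellCorner x ∈ U := by
  by_contra hcon
  rw [not_eventually] at hcon
  have hex : ∀ n : ℕ, ∃ r : ℝ, (n : ℝ) + 1 ≤ r ∧
      ¬ ∀ x ∈ latticeWindow a b fl fu r, r⁻¹ • cellCorner x ∈ U := fun n => by
    obtain ⟨r, h1, h2⟩ := (hcon.and_eventually (eventually_ge_atTop ((n : ℝ) + 1))).exists
    exact ⟨r, h2, h1⟩
  choose r hr hbad using hex
  push Not at hbad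
  choose x hx hxU using hbad
  have hr0 : ∀ n, 0 < r n := fun n => lt_of_lt_of_le (by positivity) (hr n)
  choose p hp p' hp' c1 c2 c3 c4 using fun n => hΔ.exists_near (hr0 n) (hx n).2
  have hrlim : Tendsto r atTop atTop :=
    tendsto_atTop_mono (fun n => (le_add_of_nonneg_right zero_le_one).trans (hr n))
      tendsto_natCast_atTop_atTop
  have h2r : Tendsto (fun n => 2 / r n) atTop (𝓝 0) := tendsto_const_nhds.div_atTop hrlim
  obtain ⟨M, hM⟩ := hΔ.exists_abs_le
  have h2r2 : ∀ n, 2 / r n ≤ 2 := fun n =>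
    div_le_self (by norm_num) ((le_add_of_nonneg_left (Nat.cast_nonneg n)).trans (hr n))
  have hq : ∀ n, (⌊x n 1⌋ : ℝ) / r n ∈ Set.Icc (-(M + 2)) (M + 2) := fun n => by
    constructor
    · linarith [(abs_le.1 (hM _ (hp n) 1)).1, h2r2 n, c3 n]
    · linarith [(abs_le.1 (hM _ (hp' n) 1)).2, h2r2 n, c4 n]
  -- Along a subsequence the two nearby window points converge to P, P' in Δ with a common abscissa,
  -- and the limit ordinate y lies between theirs. Vertical sections of Δ are intervals, so (P 0, y)
  -- ∈ Δ ⊆ U, contradicting that the scaled corners avoid the open set U.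
  obtain ⟨⟨P, P', y⟩, hmem, φ, hφ, hlim⟩ :=
    (hΔ.isCompact.prod (hΔ.isCompact.prod (isCompact_Icc (a := -(M + 2)) (b := M + 2)))).tendsto_subseq
      (x := fun n => (p n, p' n, (⌊x n 1⌋ : ℝ) / r n)) (fun n => ⟨hp n, hp' n, hq n⟩)
  rw [nhds_prod_eq, tendsto_prod_iff', nhds_prod_eq, tendsto_prod_iff'] at hlim
  obtain ⟨l1, l2, l3⟩ := hlim
  simp only [Function.comp_def] at l1 l2 l3
  have coord : ∀ (f : ℕ → Plane) (F : Plane), Tendsto f atTop (𝓝 F) → ∀ i,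
      Tendsto (fun n => f n i) atTop (𝓝 (F i)) := fun f F hf i =>
    ((PiLp.continuous_apply 2 _ i).tendsto F).comp hf
  have hφr := h2r.comp hφ.tendsto_atTop
  have close : ∀ (f : ℕ → ℝ) (F : ℝ), Tendsto f atTop (𝓝 F) →
      (∀ n, |(⌊x (φ n) 0⌋ : ℝ) / r (φ n) - f n| ≤ 2 / r (φ n)) →
      Tendsto (fun n => (⌊x (φ n) 0⌋ : ℝ) / r (φ n)) atTop (𝓝 F) := by
    intro f F hf hle
    have h0 : Tendsto (fun n => (⌊x (φ n) 0⌋ : ℝ) / r (φ n) - f n) atTop (𝓝 0) :=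
      squeeze_zero_norm hle hφr
    simpa using h0.add hf
  have x1 := close _ _ (coord _ _ l1 0) fun n => c1 (φ n)
  have x2 := close _ _ (coord _ _ l2 0) fun n => c2 (φ n)
  have hPP : P 0 = P' 0 := tendsto_nhds_unique x1 x2
  have y1 : P 1 ≤ y := by
    refine le_of_tendsto_of_tendsto' ((coord _ _ l1 1).sub hφr) l3 (fun n => c3 (φ n)) |>.trans' ?_
    simp
  have y2 : y ≤ P' 1 := by
    refine (le_of_tendsto_of_tendsto' l3 ((coord _ _ l2 1).add hφr) (fun n => c4 (φ n))).trans ?_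
    simp
  have hQ : !₂[P 0, y] ∈ Δ := by
    have hP : P ∈ Δ := hmem.1
    have hP' : P' ∈ Δ := hmem.2.1
    rw [hΔ.eq] at hP hP'
    refine hΔ.mk_mem ⟨hP.1, hP.2.1⟩ (hP.2.2.1.trans y1) ?_
    rw [hPP]
    exact y2.trans hP'.2.2.2
  have hconv : Tendsto (fun n => (r (φ n))⁻¹ • cellCorner (x (φ n))) atTop (𝓝 !₂[P 0, y]) := by
    have h3 : Tendsto (fun n => !₂[(⌊x (φ n) 0⌋ : ℝ) / r (φ n), (⌊x (φ n) 1⌋ : ℝ) / r (φ n)])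
        atTop (𝓝 !₂[P 0, y]) := by
      refine ((PiLp.continuous_toLp 2 _).tendsto _).comp (tendsto_pi_nhds.2 fun i => ?_)
      fin_cases i
      · exact x1
      · exact l3
    refine h3.congr fun n => ?_
    ext i
    fin_cases i <;> simp [cellCorner, div_eq_inv_mul]
  obtain ⟨n, hn⟩ := (hconv.eventually (hU.mem_nhds (hΔU hQ))).exists
  exact hxU _ hn

/-- The condition `hxb` excludes a truncated last column, whose base (i, b r] omits i. Otherwise the
corner's abscissa belongs to the base, and the infimum and supremum there enclose the corner's
ordinate. -/
theorem mem_latticeWindow (hΔ : IsWindow Δ a b fl fu) {r : ℝ} (hr : 0 < r) {x : Plane}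
    (hx : r⁻¹ • cellCorner x ∈ Δ) (hxb : (⌊x 0⌋ : ℝ) + 1 ≤ b * r) :
    x ∈ latticeWindow a b fl fu r := by
  have hmem := hx
  rw [hΔ.eq] at hmem
  simp only [cellCorner, Set.mem_ofPred_eq, PiLp.smul_apply, smul_eq_mul,
    Matrix.cons_val_zero, Matrix.cons_val_one, Matrix.cons_val_fin_one] at hmem
  obtain ⟨h1, h2, h3, h4⟩ := hmem
  have e : ∀ t : ℝ, r⁻¹ * t = t / r := fun t => by rw [div_eq_inv_mul]
  rw [e] at h1 h2 h3 h4
  rw [e] at h3 h4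
  obtain ⟨M, hM⟩ := hΔ.exists_abs_le
  have hbase : columnBase a b r ⌊x 0⌋ = Set.Ico (⌊x 0⌋ : ℝ) (⌊x 0⌋ + 1) ∩
      Set.Icc (a * r) (b * r) := by
    unfold columnBase
    rw [if_neg fun h => not_lt.2 hxb h.2]
  have hi : (⌊x 0⌋ : ℝ) ∈ columnBase a b r ⌊x 0⌋ := by
    rw [hbase]
    exact ⟨⟨le_rfl, lt_add_one _⟩, (le_div_iff₀ hr).1 h1, (div_le_iff₀ hr).1 h2⟩
  have hdiv : ∀ z ∈ columnBase a b r ⌊x 0⌋, z / r ∈ Set.Icc a b := by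
    intro z hz
    exact ⟨(le_div_iff₀ hr).2 hz.2.1, (div_le_iff₀ hr).2 hz.2.2⟩
  refine ⟨Finset.mem_Icc.2 ⟨?_, ?_⟩, ?_⟩
  · have := (Int.floor_le (a * r)).trans ((le_div_iff₀ hr).1 h1)
    exact_mod_cast this
  · have := ((div_le_iff₀ hr).1 h2).trans (Int.le_ceil (b * r))
    exact_mod_cast this
  · unfold columnRows
    rw [if_pos ⟨_, hi⟩, Finset.mem_Icc]
    constructor
    · have hb : BddBelow (dilated fl r '' columnBase a b r ⌊x 0⌋) := by
        refine ⟨r * -M, ?_⟩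
        rintro _ ⟨z, hz, rfl⟩
        have := hM _ (hΔ.mk_mem (hdiv z hz) le_rfl (hΔ.le_of_mem (hdiv z hz))) 1
        simp only [Matrix.cons_val_one, Matrix.cons_val_fin_one] at this
        exact mul_le_mul_of_nonneg_left (abs_le.1 this).1 hr.le
      have h5 := csInf_le hb ⟨_, hi, rfl⟩
      have h6 : dilated fl r ⌊x 0⌋ ≤ ⌊x 1⌋ := by
        unfold dilated
        rw [mul_comm]
        exact (le_div_iff₀ hr).1 h3
      exact_mod_cast (Int.floor_le _).trans (h5.trans h6)
    · have hb : BddAbove (dilated fu r '' columnBase a b r ⌊x 0⌋) := by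
        refine ⟨r * M, ?_⟩
        rintro _ ⟨z, hz, rfl⟩
        have := hM _ (hΔ.mk_mem (hdiv z hz) (hΔ.le_of_mem (hdiv z hz)) le_rfl) 1
        simp only [Matrix.cons_val_one, Matrix.cons_val_fin_one] at this
        exact mul_le_mul_of_nonneg_left (abs_le.1 this).2 hr.le
      have h5 := le_csSup hb ⟨_, hi, rfl⟩
      have h6 : (⌊x 1⌋ : ℝ) ≤ dilated fu r ⌊x 0⌋ := by
        unfold dilated
        rw [mul_comm]
        exact (div_le_iff₀ hr).1 h4
      exact_mod_cast h6.trans (h5.trans (Int.le_ceil _))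

theorem eventually_mem_latticeWindow (hΔ : IsWindow Δ a b fl fu) {u : Plane}
    (hu : u ∈ interior Δ) : ∀ᶠ r : ℝ in atTop, r • u ∈ latticeWindow a b fl fu r := by
  have hub : u 0 < b := by
    have hcont : Tendsto (fun δ : ℝ => u + δ • EuclideanSpace.single 0 1) (𝓝[>] 0) (𝓝 u) := by
      have : Continuous fun δ : ℝ => u + δ • EuclideanSpace.single (0 : Fin 2) (1 : ℝ) := by
        fun_prop
      have h := this.tendsto 0
      simp only [zero_smul, add_zero] at h
      exact h.mono_left nhdsWithin_le_nhds
    obtain ⟨δ, hδ, hδ0⟩ := ((hcont.eventually (mem_interior_iff_mem_nhds.1 hu)).and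
      self_mem_nhdsWithin).exists
    have := hΔ.right.2 ⟨_, hδ, rfl⟩
    simp at this
    linarith [show (0 : ℝ) < δ from hδ0]
  have hb1 : ∀ᶠ r : ℝ in atTop, 1 / (b - u 0) ≤ r := eventually_ge_atTop _
  filter_upwards [eventually_gt_atTop 0, hb1,
    (tendsto_cellCorner_smul u).eventually (mem_interior_iff_mem_nhds.1 hu)] with r hr h1 h2
  refine hΔ.mem_latticeWindow hr h2 ?_
  have h3 := Int.floor_le ((r • u) 0)
  have h4 : (r • u) 0 = r * u 0 := rfl
  rw [div_le_iff₀ (by linarith)] at h1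
  rw [h4] at h3 ⊢
  nlinarith

/-- The scaled corners of r u tend to u, whereas those of summed cells eventually avoid a closed
ball around u disjoint from Δ. -/
theorem eventually_notMem_latticeWindow (hΔ : IsWindow Δ a b fl fu) {u : Plane}
    (hu : u ∉ Δ) : ∀ᶠ r : ℝ in atTop, r • u ∉ latticeWindow a b fl fu r := by
  obtain ⟨δ, hδ, hδΔ⟩ := Metric.mem_nhds_iff.1 (hΔ.isCompact.isClosed.isOpen_compl.mem_nhds hu)
  have hU : IsOpen (Metric.closedBall u (δ / 2))ᶜ := Metric.isClosed_closedBall.isOpen_compl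
  have hsub : Δ ⊆ (Metric.closedBall u (δ / 2))ᶜ := fun p hp hpu =>
    hδΔ (Metric.closedBall_subset_ball (by linarith) hpu) hp
  filter_upwards [hΔ.eventually_lattice_subset hU hsub,
    (tendsto_cellCorner_smul u).eventually (Metric.closedBall_mem_nhds u (half_pos hδ))]
    with r h1 h2 h3
  exact h1 _ h3 h2

end IsWindow

/-! ### The normalised weight near the window. -/

theorem tendsto_div_iterate_of_tendsto_div {q : ℝ → ℝ} {t c : ℝ} (ht : 0 < t)
    (hq : ∀ᶠ s in atTop, q s ≠ 0) (h : Tendsto (fun s => q (t * s) / q s) atTop (𝓝 c)) (n : ℕ) :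
    Tendsto (fun s => q (t ^ n * s) / q s) atTop (𝓝 (c ^ n)) := by
  induction n with
  | zero =>
    refine tendsto_const_nhds.congr' ?_
    filter_upwards [hq] with s hs
    simp [hs]
  | succ n ih =>
    have hn : Tendsto (fun s : ℝ => t ^ n * s) atTop atTop :=
      tendsto_id.const_mul_atTop (by positivity)
    rw [pow_succ' c n]
    refine ((h.comp hn).mul ih).congr' ?_
    filter_upwards [hn.eventually hq] with s hs
    simp only [Function.comp]
    rw [div_mul_div_cancel₀ hs, pow_succ', mul_assoc]

namespace WeightCondition

variable {α : ℝ} {κ : ℕ} {L : ℝ → ℝ} {Δ : Set Plane} {g : Plane → ℝ}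

theorem eventually_ne_zero (hg : WeightCondition α κ L Δ g) :
    ∀ᶠ r : ℝ in atTop, g !₂[r, r] ≠ 0 := by
  filter_upwards [hg.growth.eventually_gt_atTop 0] with r hr h0
  simp [h0] at hr

/-- At one large r the normalised weight is bounded on U, since g is locally bounded, and lies
within 1 of its limit; so the limit, and with it every later normalised weight, is bounded. -/
theorem exists_bound (hg : WeightCondition α κ L Δ g) {U : Set Plane}
    (hU : Bornology.IsBounded U) {gs : Plane → ℝ}
    (h : TendstoUniformlyOn (fun (r : ℝ) (p : Plane) => g (r • p) / g !₂[r, r]) gs atTop U) :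
    ∃ C : ℝ, 0 ≤ C ∧ (∀ p ∈ U, |gs p| ≤ C) ∧
      ∀ᶠ r : ℝ in atTop, ∀ p ∈ U, |g (r • p) / g !₂[r, r]| ≤ C := by
  rw [Metric.tendstoUniformlyOn_iff] at h
  have h1 := h 1 one_pos
  obtain ⟨r, hr⟩ := h1.exists
  obtain ⟨M, hM⟩ := hU.exists_norm_le
  obtain ⟨C, hC⟩ := hg.locallyBounded (|r| * M)
  have hgs : ∀ p ∈ U, |gs p| ≤ |C| / |g !₂[r, r]| + 1 := by
    intro p hp
    have h2 := hr p hp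
    rw [Real.dist_eq] at h2
    have h3 : |g (r • p) / g !₂[r, r]| ≤ |C| / |g !₂[r, r]| := by
      rw [abs_div]
      refine div_le_div_of_nonneg_right ?_ (abs_nonneg _)
      refine (hC _ ?_).trans (le_abs_self C)
      rw [norm_smul, Real.norm_eq_abs]
      gcongr
      exact hM p hp
    have h4 := abs_sub_abs_le_abs_sub (gs p) (g (r • p) / g !₂[r, r])
    linarith
  refine ⟨|C| / |g !₂[r, r]| + 2, by positivity, fun p hp => (hgs p hp).trans (by linarith), ?_⟩
  filter_upwards [h1] with s hs p hp
  have h2 := hs p hp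
  rw [dist_comm, Real.dist_eq] at h2
  have h4 := abs_sub_abs_le_abs_sub (g (s • p) / g !₂[s, s]) (gs p)
  linarith [hgs p hp]

/-- The normalised weight converges uniformly on a bounded neighbourhood of the window to an
almost everywhere continuous function. -/
theorem exists_limit_near (hg : WeightCondition α κ L Δ g) (hΔ : IsCompact Δ)
    (h0 : (0 : Plane) ∈ interior Δ) :
    ∃ U : Set Plane, IsOpen U ∧ Bornology.IsBounded U ∧ Δ ⊆ U ∧ ∃ gs : Plane → ℝ,
      TendstoUniformlyOn (fun (r : ℝ) (p : Plane) => g (r • p) / g !₂[r, r]) gs atTop U ∧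
      ∀ᵐ p ∂(volume : Measure Plane), p ∈ U → ContinuousAt gs p := by
  obtain ⟨ε, hε, gs, hunif, -, hcont, halt⟩ := hg.limit
  have hcomp : IsCompact ((1 + ε) • Δ) := hΔ.smul (1 + ε)
  have hc : ∀ᵐ p ∂(volume : Measure Plane), p ∈ interior ((1 + ε) • Δ) → ContinuousAt gs p := by
    rw [ae_restrict_iff' hcomp.measurableSet] at hcont
    filter_upwards [hcont] with p hp hpi
    exact (hp (interior_subset hpi)).continuousAt (mem_interior_iff_mem_nhds.1 hpi)
  rcases halt with hsub | ⟨t, ht0, ht1, htm, hne⟩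
  · exact ⟨_, isOpen_interior, hcomp.isBounded.subset interior_subset, hsub, gs,
      hunif.mono interior_subset, hc⟩
  -- Here the enlarged window need not surround Δ. A contraction by t ^ n sends a ball containing Δ
  -- into its interior. With s = r / t ^ n, g(r p)/g(r,r) is the product of g(s tⁿ p)/g(s,s) and
  -- g(s,s)/g(r,r). The first factor converges uniformly, and the second tends to c ^ (-n), as c ≠
  -- 0.
  · have h0' : (0 : Plane) ∈ interior ((1 + ε) • Δ) := by
      rw [interior_smul₀ (by positivity)]
      exact ⟨0, h0, smul_zero _⟩
    obtain ⟨δ, hδ, hδΔ⟩ := Metric.mem_nhds_iff.1 (isOpen_interior.mem_nhds h0')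
    obtain ⟨M, hM0, hM⟩ := hΔ.isBounded.exists_pos_norm_lt
    obtain ⟨n, hn⟩ := exists_pow_lt_of_lt_one (div_pos hδ hM0) ht1
    rw [lt_div_iff₀ hM0] at hn
    have htn : 0 < t ^ n := by positivity
    set c := gs !₂[t, t] with hcdef
    have hscale : ∀ p ∈ Metric.ball (0 : Plane) M, t ^ n • p ∈ interior ((1 + ε) • Δ) := by
      intro p hp
      apply hδΔ
      rw [mem_ball_zero_iff, norm_smul, Real.norm_of_nonneg htn.le]
      exact (mul_lt_mul_of_pos_left (mem_ball_zero_iff.1 hp) htn).trans hn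
    have hq : Tendsto (fun s : ℝ => g !₂[t ^ n * s, t ^ n * s] / g !₂[s, s]) atTop
        (𝓝 (c ^ n)) := by
      refine tendsto_div_iterate_of_tendsto_div (q := fun s => g !₂[s, s]) ht0
        hg.eventually_ne_zero ?_ n
      refine (hunif.tendsto_at htm).congr fun s => ?_
      have : s • !₂[t, t] = !₂[t * s, t * s] := by
        ext i
        fin_cases i <;> simp [mul_comm]
      rw [this]
    have hdiv : Tendsto (fun r : ℝ => r / t ^ n) atTop atTop := tendsto_id.atTop_div_const htn
    have hq' : Tendsto (fun r : ℝ => g !₂[r / t ^ n, r / t ^ n] / g !₂[r, r]) atTop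
        (𝓝 (c ^ n)⁻¹) := by
      refine ((hq.comp hdiv).inv₀ (pow_ne_zero n hne)).congr fun r => ?_
      simp only [Function.comp]
      rw [mul_div_cancel₀ _ htn.ne', inv_div]
    refine ⟨Metric.ball 0 M, Metric.isOpen_ball, Metric.isBounded_ball,
      fun p hp => mem_ball_zero_iff.2 (hM p hp), fun p => gs (t ^ n • p) * (c ^ n)⁻¹, ?_, ?_⟩
    · obtain ⟨C, hC0, hCgs, -⟩ := hg.exists_bound hcomp.isBounded hunif
      rw [Metric.tendstoUniformlyOn_iff] at hunif ⊢
      intro η hη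
      set A := |(c ^ n)⁻¹| + 1 with hA
      have hA0 : 0 < A := by positivity
      have e1 := hdiv.eventually (hunif (η / (2 * A)) (by positivity))
      have e2 := Metric.tendsto_nhds.1 hq' (η / (2 * (C + 1))) (by positivity)
      have e3 : ∀ᶠ r : ℝ in atTop, |g !₂[r / t ^ n, r / t ^ n] / g !₂[r, r]| < A :=
        hq'.abs.eventually (gt_mem_nhds (lt_add_one _))
      filter_upwards [e1, e2, e3, hdiv.eventually hg.eventually_ne_zero] with r r1 r2 r3 r4 p hp
      have hp' := interior_subset (hscale p hp)
      have s1 := r1 _ hp'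
      have e : (r / t ^ n) • t ^ n • p = r • p := by
        rw [smul_smul, div_mul_cancel₀ _ htn.ne']
      rw [e, dist_comm, Real.dist_eq] at s1
      rw [Real.dist_eq] at r2
      have hG := hCgs _ hp'
      set a := g !₂[r / t ^ n, r / t ^ n] / g !₂[r, r]
      set G := gs (t ^ n • p)
      have efac : g (r • p) / g !₂[r, r] = g (r • p) / g !₂[r / t ^ n, r / t ^ n] * a :=
        (div_mul_div_cancel₀ r4).symm
      rw [efac, dist_comm, Real.dist_eq]
      set b := g (r • p) / g !₂[r / t ^ n, r / t ^ n]
      calc |b * a - G * (c ^ n)⁻¹| = |(b - G) * a + G * (a - (c ^ n)⁻¹)| := by ring_nf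
        _ ≤ |b - G| * |a| + |G| * |a - (c ^ n)⁻¹| := by
            rw [← abs_mul, ← abs_mul]; exact abs_add_le _ _
        _ ≤ η / (2 * A) * A + C * (η / (2 * (C + 1))) := by gcongr
        _ < η / (2 * A) * A + (C + 1) * (η / (2 * (C + 1))) := by
            have : 0 < η / (2 * (C + 1)) := by positivity
            nlinarith
        _ = η := by field_simp; ring
    · have hnull : ∀ᵐ p ∂(volume : Measure Plane),
          t ^ n • p ∈ interior ((1 + ε) • Δ) → ContinuousAt gs (t ^ n • p) := by
        rw [ae_iff] at hc ⊢
        have := Measure.addHaar_preimage_smul (volume : Measure Plane) htn.ne'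
          {p | ¬(p ∈ interior ((1 + ε) • Δ) → ContinuousAt gs p)}
        rw [hc, mul_zero] at this
        exact this
      filter_upwards [hnull] with p hp hpM
      have := hp (hscale p hpM)
      exact (ContinuousAt.comp (f := fun p : Plane => t ^ n • p) this (by fun_prop)).mul_const _

end WeightCondition

/-! ### Rescaling of both functionals and their weights to a fixed ball. -/

theorem integral_sub_sq_eq {Ω : Type*} [MeasurableSpace Ω] {μ : Measure Ω} {X Y : Ω → ℝ}
    (hX : MemLp X 2 μ) (hY : MemLp Y 2 μ) :
    ∫ ω, (X ω - Y ω) ^ 2 ∂μ =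
      ∫ ω, X ω * X ω ∂μ - 2 * ∫ ω, X ω * Y ω ∂μ + ∫ ω, Y ω * Y ω ∂μ := by
  have iXX : Integrable (fun ω => X ω * X ω) μ := hX.integrable_mul hX
  have iXY : Integrable (fun ω => 2 * (X ω * Y ω)) μ := (hX.integrable_mul hY).const_mul 2
  have iYY : Integrable (fun ω => Y ω * Y ω) μ := hY.integrable_mul hY
  have iS : Integrable (fun ω => X ω * X ω - 2 * (X ω * Y ω)) μ := iXX.sub iXY
  rw [← integral_const_mul, ← integral_sub iXX iXY, ← integral_add iS iYY]
  congr 1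
  ext ω
  ring

theorem integral_eq_integral_closedBall {f : Plane → ℝ} {R : ℝ} (h : ∀ u, f u ≠ 0 → ‖u‖ ≤ R) :
    ∫ u, f u = ∫ u in Metric.closedBall 0 R, f u := by
  refine (setIntegral_eq_integral_of_forall_compl_eq_zero fun u hu => ?_).symm
  by_contra hne
  exact hu (mem_closedBall_zero_iff.2 (h u hne))

/-- The weight of the integral functional, rescaled to the fixed window. -/
noncomputable def windowWeight (g : Plane → ℝ) (Δ : Set Plane) (r : ℝ) : Plane → ℝ :=
  Δ.indicator fun u => g (r • u) / g !₂[r, r]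

/-- The weight of the additive functional, rescaled to the fixed window. -/
noncomputable def latticeWeight (g : Plane → ℝ) (a b : ℝ) (fl fu : ℝ → ℝ) (r : ℝ) (u : Plane) : ℝ :=
  (latticeWindow a b fl fu r).indicator (fun x => g (cellCorner x) / g !₂[r, r]) (r • u)

section Functionals

variable {Ω : Type*} (ξ : Plane → Ω → ℝ) {g : Plane → ℝ} (κ : ℕ) {Δ : Set Plane}
  {a b : ℝ} {fl fu : ℝ → ℝ} {r R : ℝ}

theorem integralFunctional_eq (hΔ : MeasurableSet Δ) (hr : 0 < r) (hg : g !₂[r, r] ≠ 0)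
    (hR : ∀ u, windowWeight g Δ r u ≠ 0 → ‖u‖ ≤ R) (ω : Ω) :
    integralFunctional ξ g κ Δ r ω = r ^ 2 * g !₂[r, r] *
      ∫ u in Metric.closedBall 0 R, windowWeight g Δ r u * hermiteFun κ (ξ (r • u) ω) := by
  have h1 := Measure.setIntegral_comp_smul_of_pos (volume : Measure Plane)
    (fun p => g p * hermiteFun κ (ξ p ω)) Δ hr
  have hfin : Module.finrank ℝ Plane = 2 := by simp
  rw [hfin, smul_eq_mul] at h1
  rw [← integral_eq_integral_closedBall fun u hu => hR u (left_ne_zero_of_mul hu)]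
  have h2 : ∫ u : Plane, windowWeight g Δ r u * hermiteFun κ (ξ (r • u) ω) =
      (∫ u in Δ, g (r • u) * hermiteFun κ (ξ (r • u) ω)) / g !₂[r, r] := by
    rw [← integral_div, ← integral_indicator hΔ]
    congr 1
    ext u
    by_cases hu : u ∈ Δ
    · simp only [windowWeight, Set.indicator_of_mem hu]
      ring
    · simp [windowWeight, Set.indicator_of_notMem hu]
  rw [h2, h1, integralFunctional]
  field_simp

theorem additiveFunctional_eq (hr : 0 < r) (hg : g !₂[r, r] ≠ 0)
    (hR : ∀ u, latticeWeight g a b fl fu r u ≠ 0 → ‖u‖ ≤ R) (ω : Ω) :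
    additiveFunctional ξ g κ a b fl fu r ω = r ^ 2 * g !₂[r, r] *
      ∫ u in Metric.closedBall 0 R, latticeWeight g a b fl fu r u *
        hermiteFun κ (ξ (cellCorner (r • u)) ω) := by
  have h1 := Measure.integral_comp_smul_of_nonneg (volume : Measure Plane)
    ((latticeWindow a b fl fu r).indicator
      fun x => g (cellCorner x) * hermiteFun κ (ξ (cellCorner x) ω)) r (hR := hr.le)
  have hfin : Module.finrank ℝ Plane = 2 := by simp
  rw [hfin, smul_eq_mul] at h1
  rw [← integral_eq_integral_closedBall fun u hu => hR u (left_ne_zero_of_mul hu),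
    additiveFunctional,
    sum_lattice_eq_integral a b fl fu r (fun p => g p * hermiteFun κ (ξ p ω))]
  have h2 : ∫ u : Plane, latticeWeight g a b fl fu r u * hermiteFun κ (ξ (cellCorner (r • u)) ω) =
      (∫ u : Plane, (latticeWindow a b fl fu r).indicator
        (fun x => g (cellCorner x) * hermiteFun κ (ξ (cellCorner x) ω)) (r • u)) / g !₂[r, r] := by
    rw [← integral_div]
    congr 1
    ext u
    by_cases hu : r • u ∈ latticeWindow a b fl fu r
    · simp only [latticeWeight, Set.indicator_of_mem hu]
      ring
    · simp [latticeWeight, Set.indicator_of_notMem hu]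
  rw [h2, h1]
  field_simp

end Functionals

section Weights

variable {g : Plane → ℝ} {Δ U : Set Plane} {a b C : ℝ} {fl fu : ℝ → ℝ} {gs : Plane → ℝ}

theorem measurable_windowWeight (hg : Measurable g) (hΔ : MeasurableSet Δ) (r : ℝ) :
    Measurable (windowWeight g Δ r) :=
  ((hg.comp (measurable_const_smul r)).div_const _).indicator hΔ

theorem measurable_latticeWeight (hg : Measurable g) (r : ℝ) :
    Measurable (latticeWeight g a b fl fu r) :=
  (((hg.comp measurable_cellCorner).div_const _).indicator
    (measurableSet_latticeWindow a b fl fu r)).comp (measurable_const_smul r)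

theorem abs_windowWeight_le (hC : 0 ≤ C) (hΔU : Δ ⊆ U) {r : ℝ}
    (hr : ∀ p ∈ U, |g (r • p) / g !₂[r, r]| ≤ C) (u : Plane) : |windowWeight g Δ r u| ≤ C := by
  by_cases hu : u ∈ Δ
  · rw [windowWeight, Set.indicator_of_mem hu]
    exact hr u (hΔU hu)
  · simpa [windowWeight, hu] using hC

theorem abs_latticeWeight_le (hC : 0 ≤ C) {r : ℝ} (hr0 : 0 < r)
    (hr : ∀ p ∈ U, |g (r • p) / g !₂[r, r]| ≤ C)
    (hlat : ∀ x ∈ latticeWindow a b fl fu r, r⁻¹ • cellCorner x ∈ U) (u : Plane) :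
    |latticeWeight g a b fl fu r u| ≤ C := by
  by_cases hu : r • u ∈ latticeWindow a b fl fu r
  · rw [latticeWeight, Set.indicator_of_mem hu]
    have := hr _ (hlat _ hu)
    rwa [smul_inv_smul₀ hr0.ne'] at this
  · simpa [latticeWeight, hu] using hC

theorem norm_le_of_windowWeight_ne_zero {M r : ℝ} (hM : ∀ p ∈ Δ, ‖p‖ ≤ M) {u : Plane}
    (hu : windowWeight g Δ r u ≠ 0) : ‖u‖ ≤ M :=
  hM u (Set.mem_of_indicator_ne_zero hu)

theorem norm_le_of_latticeWeight_ne_zero {M r : ℝ} (hM : ∀ p ∈ U, ‖p‖ ≤ M) (hr : 1 ≤ r)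
    (hlat : ∀ x ∈ latticeWindow a b fl fu r, r⁻¹ • cellCorner x ∈ U) {u : Plane}
    (hu : latticeWeight g a b fl fu r u ≠ 0) : ‖u‖ ≤ M + 2 := by
  have h1 := hM _ (hlat _ (Set.mem_of_indicator_ne_zero hu))
  have hr0 : 0 < r := by linarith
  have e : u = r⁻¹ • cellCorner (r • u) - r⁻¹ • (cellCorner (r • u) - r • u) := by
    rw [smul_sub, inv_smul_smul₀ hr0.ne']
    abel
  have h2 : ‖r⁻¹ • (cellCorner (r • u) - r • u)‖ ≤ 2 := by
    rw [norm_smul, norm_inv, Real.norm_of_nonneg hr0.le]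
    have h3 := norm_cellCorner_sub_le (r • u)
    have h4 : r⁻¹ ≤ 1 := inv_le_one_of_one_le₀ hr
    have h5 : 0 < r⁻¹ := by positivity
    nlinarith [norm_nonneg (cellCorner (r • u) - r • u)]
  rw [e]
  exact (norm_sub_le _ _).trans (by linarith)

theorem tendsto_windowWeight (hΔU : Δ ⊆ U)
    (h : TendstoUniformlyOn (fun (r : ℝ) (p : Plane) => g (r • p) / g !₂[r, r]) gs atTop U)
    (u : Plane) :
    Tendsto (fun r => windowWeight g Δ r u) atTop (𝓝 (Δ.indicator gs u)) := by
  by_cases hu : u ∈ Δ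
  · simp only [windowWeight, Set.indicator_of_mem hu]
    exact h.tendsto_at (hΔU hu)
  · simp only [windowWeight, Set.indicator_of_notMem hu]
    exact tendsto_const_nhds

/-- Off the frontier, membership in the lattice window stabilises. Inside, the weight is sampled at
moving points tending to u, so pointwise convergence is not enough: uniform convergence is combined
with continuity of the limit at u. -/
theorem tendsto_latticeWeight (hΔ : IsWindow Δ a b fl fu) (hU : IsOpen U) (hΔU : Δ ⊆ U)
    (h : TendstoUniformlyOn (fun (r : ℝ) (p : Plane) => g (r • p) / g !₂[r, r]) gs atTop U)
    {u : Plane} (hu : u ∉ frontier Δ) (hc : u ∈ U → ContinuousAt gs u) :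
    Tendsto (fun r => latticeWeight g a b fl fu r u) atTop (𝓝 (Δ.indicator gs u)) := by
  by_cases huΔ : u ∈ Δ
  · have hint : u ∈ interior Δ := by
      by_contra hcon
      exact hu ⟨subset_closure huΔ, hcon⟩
    rw [Set.indicator_of_mem huΔ]
    have key := tendsto_comp_of_locally_uniform_limit (hc (hΔU huΔ)) (tendsto_cellCorner_smul u)
      (F := fun (r : ℝ) (p : Plane) => g (r • p) / g !₂[r, r])
      fun V hV => ⟨U, hU.mem_nhds (hΔU huΔ), h V hV⟩
    refine key.congr' ?_
    filter_upwards [hΔ.eventually_mem_latticeWindow hint, eventually_gt_atTop 0] with r h1 h2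
    rw [latticeWeight, Set.indicator_of_mem h1, smul_inv_smul₀ h2.ne']
  · rw [Set.indicator_of_notMem huΔ]
    refine tendsto_const_nhds.congr' ?_
    filter_upwards [hΔ.eventually_notMem_latticeWindow huΔ] with r h1
    rw [latticeWeight, Set.indicator_of_notMem h1]

end Weights

namespace IsGaussianField

variable {Ω : Type*} [MeasurableSpace Ω] {μ : Measure Ω} {ξ : Plane → Ω → ℝ} {B : ℝ → ℝ}

/-- Measurability is inherited from the joint measurability of the field, the covariance being an
integral over Ω. -/
theorem measurable_covariance [SFinite μ] (hξ : IsGaussianField μ ξ B) :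
    Measurable fun z : Plane × Plane => B ‖z.1 - z.2‖ := by
  simp_rw [← hξ.covariance]
  have hm : Measurable fun q : (Plane × Plane) × Ω => ξ q.1.1 q.2 * ξ q.1.2 q.2 :=
    (hξ.measurable.comp ((measurable_fst.comp measurable_fst).prodMk measurable_snd)).mul
      (hξ.measurable.comp ((measurable_snd.comp measurable_fst).prodMk measurable_snd))
  exact hm.stronglyMeasurable.integral_prod_right'.measurable

theorem memLp_additiveFunctional (hξ : IsGaussianField μ ξ B) (g : Plane → ℝ) (κ : ℕ) (a b : ℝ)
    (fl fu : ℝ → ℝ) (r : ℝ) : MemLp (additiveFunctional ξ g κ a b fl fu r) 2 μ := by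
  unfold additiveFunctional
  exact memLp_finsetSum _ fun i _ => memLp_finsetSum _ fun j _ =>
    (hξ.memLp_hermite κ _).const_mul _

end IsGaussianField

/-! ### The theorem: three equal limits cancel. -/

theorem theorem4 {Ω : Type*} [MeasurableSpace Ω] (μ : Measure Ω) [IsProbabilityMeasure μ]
    (κ : ℕ) (hκ : 1 ≤ κ) (α : ℝ) (hα : 0 < α) (hακ : α < 2 / κ)
    (B L₀ L : ℝ → ℝ) (ξ : Plane → Ω → ℝ)
    (hξ : IsGaussianField μ ξ B)
    (hB : CovarianceCondition α B L₀)
    (hL : SpectralCondition α B L₀ L)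
    (Δ : Set Plane) (a b : ℝ) (fl fu : ℝ → ℝ) (hΔ : IsWindow Δ a b fl fu)
    (g : Plane → ℝ) (hg : WeightCondition α κ L Δ g) :
    (∀ r : ℝ, 0 < r →
      (∀ᵐ ω ∂μ, IntegrableOn (fun p : Plane => g p * hermiteFun κ (ξ p ω)) (r • Δ)) ∧
      MemLp (fun ω => integralFunctional ξ g κ Δ r ω -
        additiveFunctional ξ g κ a b fl fu r ω) 2 μ) ∧
    Tendsto (fun r : ℝ =>
      (∫ ω, (integralFunctional ξ g κ Δ r ω - additiveFunctional ξ g κ a b fl fu r ω) ^ 2 ∂μ) /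
        (r ^ (4 - α * κ) * L r ^ κ * g !₂[r, r] ^ 2)) atTop (𝓝 0) := by
  have hB0 : B 0 = 1 := hB.at_zero
  have hgm := hg.measurable
  have hΔm : MeasurableSet Δ := hΔ.isCompact.measurableSet
  have hL2 : ∀ r : ℝ, 0 < r → (∀ᵐ ω ∂μ,
      IntegrableOn (fun p : Plane => g p * hermiteFun κ (ξ p ω)) (r • Δ)) ∧
      MemLp (integralFunctional ξ g κ Δ r) 2 μ := by
    intro r _
    have hc : IsCompact (r • Δ) := hΔ.isCompact.smul r
    obtain ⟨M, hM⟩ := hc.isBounded.exists_norm_le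
    obtain ⟨C, hC⟩ := hg.locallyBounded M
    have : IsFiniteMeasure (volume.restrict (r • Δ)) := isFiniteMeasure_restrict.2 hc.measure_ne_top
    have hae : ∀ᵐ p ∂(volume.restrict (r • Δ)), |g p| ≤ C := by
      filter_upwards [ae_restrict_mem hc.measurableSet] with p hp
      exact hC p (hM p hp)
    exact ⟨hξ.ae_integrable_mul_hermite hB0 κ measurable_id hgm hae,
      hξ.memLp_integral hB0 κ measurable_id hgm hae⟩
  refine ⟨fun r hr => ⟨(hL2 r hr).1,
    (hL2 r hr).2.sub (hξ.memLp_additiveFunctional g κ a b fl fu r)⟩, ?_⟩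
  obtain ⟨U, hU, hUb, hΔU, gs, hunif, hcont⟩ := hg.exists_limit_near hΔ.isCompact hΔ.zero_mem
  obtain ⟨C, hC0, -, hC⟩ := hg.exists_bound hUb hunif
  obtain ⟨M, hM⟩ := hUb.exists_norm_le
  set K : ℝ → ℝ := fun t => B t ^ κ with hKdef
  have hBnn : ∀ t, 0 ≤ t → 0 ≤ B t := by
    intro t ht
    rcases ht.eq_or_lt with rfl | ht
    · rw [hB0]; exact zero_le_one
    · rw [hB.eq t ht]
      have := hB.slowlyVarying.pos t ht
      positivity
  have hK : ∀ t, 0 < t → K t = t ^ (-(α * κ)) * L₀ t ^ κ := by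
    intro t ht
    simp only [hKdef]
    rw [hB.eq t ht, mul_pow, ← Real.rpow_natCast (t ^ (-α)), ← Real.rpow_mul ht.le, neg_mul]
  have hκ0 : (0 : ℝ) < κ := by exact_mod_cast hκ
  have hβ : α * κ < 2 := (lt_div_iff₀ hκ0).1 hακ
  -- U lies in the ball of radius M, and for r ≥ 1 a point is within 2 of its scaled corner, so this
  -- ball carries both weights.
  set ν : Measure Plane := volume.restrict (Metric.closedBall 0 (M + 2)) with hν
  have : IsFiniteMeasure ν := isFiniteMeasure_restrict.2 measure_closedBall_lt_top.ne
  set w := windowWeight g Δ with hw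
  set l := latticeWeight g a b fl fu with hl
  have hwm : ∀ r, Measurable (w r) := measurable_windowWeight hgm hΔm
  have hlm : ∀ r, Measurable (l r) := measurable_latticeWeight hgm
  have hlat := hΔ.eventually_lattice_subset hU hΔU
  have hwC : ∀ᶠ r in atTop, ∀ u, |w r u| ≤ C := by
    filter_upwards [hC] with r hr
    exact abs_windowWeight_le hC0 hΔU hr
  have hlC : ∀ᶠ r in atTop, ∀ u, |l r u| ≤ C := by
    filter_upwards [hC, hlat, eventually_gt_atTop 0] with r h1 h2 h3
    exact abs_latticeWeight_le hC0 h3 h1 h2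
  have hwlim : ∀ᵐ u ∂(volume : Measure Plane),
      Tendsto (fun r => w r u) atTop (𝓝 (Δ.indicator gs u)) :=
    ae_of_all _ (tendsto_windowWeight hΔU hunif)
  have hllim : ∀ᵐ u ∂(volume : Measure Plane),
      Tendsto (fun r => l r u) atTop (𝓝 (Δ.indicator gs u)) := by
    filter_upwards [hcont, measure_eq_zero_iff_ae_notMem.1 hΔ.jordan] with u h1 h2
    exact tendsto_latticeWeight hΔ hU hΔU hunif h2 h1
  have mφ : ∀ r : ℝ, Measurable fun u : Plane => r • u := fun r => measurable_const_smul r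
  have mψ : ∀ r : ℝ, Measurable fun u : Plane => cellCorner (r • u) := fun r =>
    measurable_cellCorner.comp (mφ r)
  have nφ : ∀ (r : ℝ) (u : Plane), ‖r • u - r • u‖ ≤ 2 := fun r u => by simp
  have nψ : ∀ (r : ℝ) (u : Plane), ‖cellCorner (r • u) - r • u‖ ≤ 2 := fun r u =>
    norm_cellCorner_sub_le _
  have hKm : Measurable fun z : Plane × Plane => K ‖z.1 - z.2‖ :=
    hξ.measurable_covariance.pow_const κ
  have hK0 : ∀ t, 0 ≤ t → 0 ≤ K t := fun t ht => pow_nonneg (hBnn t ht) κ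
  have hK1 : ∀ t, 0 ≤ t → K t ≤ 1 := fun t ht =>
    pow_le_one₀ (hBnn t ht) (hξ.covariance_le_one hB0 ht)
  have hSV := hB.slowlyVarying.pow κ
  have hβ0 : 0 ≤ α * κ := by positivity
  have J₁ := tendsto_integral_kernel (R := M + 2) hSV hK hK0 hK1 hKm hβ0 hβ hwm hwm mφ mφ nφ nφ
    hwC hwC hwlim hwlim
  have J₂ := tendsto_integral_kernel (R := M + 2) hSV hK hK0 hK1 hKm hβ0 hβ hwm hlm mφ mψ nφ nψ
    hwC hlC hwlim hllim
  have J₃ := tendsto_integral_kernel (R := M + 2) hSV hK hK0 hK1 hKm hβ0 hβ hlm hlm mψ mψ nψ nψ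
    hlC hlC hllim hllim
  rw [← hν] at J₁ J₂ J₃
  -- The kernel is normalised by B(r)^κ, which involves L₀, while the denominator in the theorem
  -- involves L.
  have hratio : Tendsto (fun r => (L₀ r / L r) ^ κ) atTop (𝓝 1) := by
    have h := (hL.equivalent.inv₀ one_ne_zero).pow κ
    simpa only [inv_div, inv_one, one_pow] using h
  have hfinal := (((J₁.sub (J₂.const_mul 2)).add J₃).const_mul (κ.factorial : ℝ)).mul hratio
  have hzero : ∀ I : ℝ, (κ.factorial : ℝ) * (I - 2 * I + I) * 1 = 0 := fun I => by ring
  rw [hzero] at hfinal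
  refine hfinal.congr' ?_
  filter_upwards [eventually_ge_atTop 1, hg.eventually_ne_zero, hlat, hwC, hlC]
    with r hr1 hq hlatr hwr hlr
  have hr0 : 0 < r := by linarith
  have hwR : ∀ u, w r u ≠ 0 → ‖u‖ ≤ M + 2 := fun u hu => by
    linarith [norm_le_of_windowWeight_ne_zero (fun p hp => hM p (hΔU hp)) hu]
  have hlR : ∀ u, l r u ≠ 0 → ‖u‖ ≤ M + 2 := fun u hu =>
    norm_le_of_latticeWeight_ne_zero hM hr1 hlatr hu
  have hwν : ∀ᵐ u ∂ν, |w r u| ≤ C := ae_of_all _ hwr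
  have hlν : ∀ᵐ u ∂ν, |l r u| ≤ C := ae_of_all _ hlr
  have e : ∀ ω, (integralFunctional ξ g κ Δ r ω - additiveFunctional ξ g κ a b fl fu r ω) ^ 2 =
      (r ^ 2 * g !₂[r, r]) ^ 2 * (∫ u, w r u * hermiteFun κ (ξ (r • u) ω) ∂ν -
        ∫ u, l r u * hermiteFun κ (ξ (cellCorner (r • u)) ω) ∂ν) ^ 2 := by
    intro ω
    rw [integralFunctional_eq ξ κ hΔm hr0 hq hwR, additiveFunctional_eq ξ κ hr0 hq hlR]
    ring
  simp_rw [e]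
  rw [integral_const_mul, integral_sub_sq_eq (hξ.memLp_integral hB0 κ (mφ r) (hwm r) hwν)
      (hξ.memLp_integral hB0 κ (mψ r) (hlm r) hlν),
    (hξ.integral_mul_integral hB0 κ (mφ r) (mφ r) (hwm r) (hwm r) hwν hwν).2,
    (hξ.integral_mul_integral hB0 κ (mφ r) (mψ r) (hwm r) (hlm r) hwν hlν).2,
    (hξ.integral_mul_integral hB0 κ (mψ r) (mψ r) (hlm r) (hlm r) hlν hlν).2]
  have hL₀r := hB.slowlyVarying.pos r hr0
  have hLr := hL.slowlyVarying.pos r hr0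
  have hrp : r ^ (4 - α * κ) = r ^ 4 * r ^ (-(α * κ)) := by
    rw [sub_eq_add_neg, Real.rpow_add hr0]
    norm_cast
  -- The prefactor (r² g(r,r))² over the denominator of the theorem equals (L₀ r / L r)^κ / K r,
  -- which is the normalisation in `hfinal`.
  rw [hK r hr0, hrp, div_pow]
  have hrβ : 0 < r ^ (-(α * κ)) := by positivity
  field_simp
  ring
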